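/- **Theorem 7.2.** *Setting.* A confidence level is a pair $\langle[\alpha,\beta],[\gamma,\delta]\rangle$ (belief, doubt) of intervals with bounds in $[0,1]$; it is consistent if some reals $w_1,w_0,w_\bot\ge 0$ with $w_1+w_0+w_\bot=1$ satisfy $\alpha\le w_1\le\beta$ and $\gamma\le w_0\le\delta$. Put $\langle[\alpha,\beta],[\gamma,\delta]\rangle\le_t\langle[\alpha',\beta'],[\gamma',\delta']\rangle$ iff $\alpha\le\alpha'$, $\beta\le\beta'$, $\gamma'\le\gamma$, $\delta'\le\delta$; the least element is $\bot_t=\langle[0,0],[1,1]\rangle$. Write $a\odot b=\max\{0,a+b-1\}$, $a\oplus b=\min\{1,a+b\}$, $a\star b=1-(1-a)(1-b)$. Conjunction under the modes ignorance, independence, positive correlation, negative correlation, mutual exclusion acts on the bounds $(\alpha,\beta,\gamma,\delta)$ by $$(\odot,\min,\max,\oplus),\quad(\cdot,\cdot,\star,\star),\quad(\min,\min,\max,\max),\quad(\odot,\odot,\oplus,\oplus),\quad(0,0,\oplus,\oplus),$$ and disjunction by $$(\max,\oplus,\odot,\min),\quad(\star,\star,\cdot,\cdot),\quad(\max,\max,\min,\min),\quad(\oplus,\oplus,\odot,\odot),\quad(\oplus,\oplus,\odot,\odot).$$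 A p-program $P$ over a finite set of predicates with given arities is a finite set of function-free, range restricted p-rules. Each is either a fact $A\xleftarrow{c}$ or a rule $(A\xleftarrow{c}B_1,\dots,B_m;\mu_r)$ with $m\ge1$, where $A$ and the $B_i$ are atoms, $c$ is a consistent confidence level and $\mu_r$ is a conjunctive mode. In addition, each predicate has one disjunctive mode. The Herbrand universe is the set of constants occurring in $P$ (one arbitrary constant if there are none), $B_P$ is the set of ground atoms over it, and $P^*$ is the set of ground instances of the p-rules of $P$ over it. A valuation is a map $v$ from $B_P$ to confidence levels; valuations are ordered pointwise by $\le_t$. The operator $T_P$ maps $v$ to the valuation whose value at $A\in B_P$ is the disjunction, in the disjunctive mode of the predicate of $A$, of the confidences $c\wedge_{\mu_r}v(B_1)\wedge_{\mu_r}\cdots\wedge_{\mu_r}v(B_m)$, one for each p-rule in $P^*$ with head $A$ (just $c$ for a fact; $\bot_t$ if there is no such p-rule). A predicate is recursive if it depends on itself, directly or through other predicates, where the head predicate of a rule depends on the predicates in its body. The database size $n$ of $P$ is the number of constants occurring in $P$. *Claim.* Fix the predicates and their arities, the disjunctive modes, a finite set $R$ of rules with nonempty body, and a number $m$. There is a polynomial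 $q$ such that the following holds for every p-program $P$ with these predicates and modes which consists of the rules in $R$ together with ground facts, at most $m$ for each ground atom, and in which every recursive predicate has positive correlation as its disjunctive mode. The operator $T_P$ has a least fixpoint, and naive bottom-up evaluation computes it: starting from the valuation that is constantly $\bot_t$, it applies $T_P$ repeatedly until nothing changes; it halts after at most $q(n)$ iterations (the last, verifying one included), its output is the table of the least fixpoint, each iteration uses at most $q(n)$ elementary operations, and the whole evaluation, including the computation of $P^*$ and $B_P$ from $P$, uses at most $q(n)$ elementary operations. Elementary operations are visits of list cells, equality tests of symbols, and exact comparisons and arithmetic operations on real numbers, each at unit cost. In particular, the least fixpoint of $T_P$ can be computed in time polynomial in the database size. -/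

import Mathlib

noncomputable section

namespace PDatalog

/-! ### Confidence levels -/

/-- The modes of event interaction: ignorance, independence, positive correlation,
negative correlation, mutual exclusion. -/
inductive Mode
  | ig | ind | pc | nc | me

/-- A confidence level `⟨[bLo, bHi], [dLo, dHi]⟩`: a belief interval and a doubt interval
over `[0, 1]`. Empty intervals such as `[1, 0]` are elements, as the top of the precision
order requires. -/
@[ext]
structure Conf where
  bLo : unitInterval
  bHi : unitInterval
  dLo : unitInterval
  dHi : unitInterval

/-- `max {0, a + b - 1}` -/
def luk (a b : unitInterval) : unitInterval :=
  ⟨max 0 ((a : ℝ) + b - 1), le_max_left _ _,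
    max_le zero_le_one (by have := a.2.2; have := b.2.2; linarith)⟩

/-- `min {1, a + b}` -/
def bsum (a b : unitInterval) : unitInterval :=
  ⟨min 1 ((a : ℝ) + b), le_min zero_le_one (add_nonneg a.2.1 b.2.1), min_le_left _ _⟩

/-- `1 - (1 - a) * (1 - b)` -/
def psum (a b : unitInterval) : unitInterval :=
  unitInterval.symm (unitInterval.symm a * unitInterval.symm b)

namespace Conf

/-- Conjunction of confidence levels under a mode. -/
def conj : Mode → Conf → Conf → Conf
  | .ig, c, d => ⟨luk c.bLo d.bLo, min c.bHi d.bHi, max c.dLo d.dLo, bsum c.dHi d.dHi⟩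
  | .ind, c, d => ⟨c.bLo * d.bLo, c.bHi * d.bHi, psum c.dLo d.dLo, psum c.dHi d.dHi⟩
  | .pc, c, d => ⟨min c.bLo d.bLo, min c.bHi d.bHi, max c.dLo d.dLo, max c.dHi d.dHi⟩
  | .nc, c, d => ⟨luk c.bLo d.bLo, luk c.bHi d.bHi, bsum c.dLo d.dLo, bsum c.dHi d.dHi⟩
  | .me, c, d => ⟨0, 0, bsum c.dLo d.dLo, bsum c.dHi d.dHi⟩

/-- Disjunction of confidence levels under a mode. Mutual exclusion presupposes that the
beliefs add up to at most `1`; the sum is truncated at `1`, so that the operation is total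
and agrees with plain addition whenever the presupposition holds. -/
def disj : Mode → Conf → Conf → Conf
  | .ig, c, d => ⟨max c.bLo d.bLo, bsum c.bHi d.bHi, luk c.dLo d.dLo, min c.dHi d.dHi⟩
  | .ind, c, d => ⟨psum c.bLo d.bLo, psum c.bHi d.bHi, c.dLo * d.dLo, c.dHi * d.dHi⟩
  | .pc, c, d => ⟨max c.bLo d.bLo, max c.bHi d.bHi, min c.dLo d.dLo, min c.dHi d.dHi⟩
  | .nc, c, d => ⟨bsum c.bLo d.bLo, bsum c.bHi d.bHi, luk c.dLo d.dLo, luk c.dHi d.dHi⟩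
  | .me, c, d => ⟨bsum c.bLo d.bLo, bsum c.bHi d.bHi, luk c.dLo d.dLo, luk c.dHi d.dHi⟩

/-- The truth order: more belief, less doubt. -/
instance : PartialOrder Conf where
  le c d := c.bLo ≤ d.bLo ∧ c.bHi ≤ d.bHi ∧ d.dLo ≤ c.dLo ∧ d.dHi ≤ c.dHi
  le_refl _ := ⟨le_rfl, le_rfl, le_rfl, le_rfl⟩
  le_trans _ _ _ h k := ⟨h.1.trans k.1, h.2.1.trans k.2.1, k.2.2.1.trans h.2.2.1,
    k.2.2.2.trans h.2.2.2⟩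
  le_antisymm _ _ h k := Conf.ext (le_antisymm h.1 k.1) (le_antisymm h.2.1 k.2.1)
    (le_antisymm k.2.2.1 h.2.2.1) (le_antisymm k.2.2.2 h.2.2.2)

/-- The least element `⟨[0, 0], [1, 1]⟩` of the truth order. -/
def falsum : Conf := ⟨0, 0, 1, 1⟩

/-- Some probabilities of true, false, unknown (nonnegative, of sum `1`) lie within the
bounds. -/
def Consistent (c : Conf) : Prop :=
  ∃ w₁ w₀ w : ℝ, 0 ≤ w₁ ∧ 0 ≤ w₀ ∧ 0 ≤ w ∧ w₁ + w₀ + w = 1 ∧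
    (c.bLo : ℝ) ≤ w₁ ∧ w₁ ≤ c.bHi ∧ (c.dLo : ℝ) ≤ w₀ ∧ w₀ ≤ c.dHi

end Conf

theorem luk_comm (a b : unitInterval) : luk a b = luk b a := by
  apply Subtype.ext; simp only [luk, add_comm]

theorem bsum_comm (a b : unitInterval) : bsum a b = bsum b a := by
  apply Subtype.ext; simp only [bsum, add_comm]

theorem psum_comm (a b : unitInterval) : psum a b = psum b a := by
  simp only [psum, mul_comm]

theorem luk_assoc (a b c : unitInterval) : luk (luk a b) c = luk a (luk b c) := by
  apply Subtype.ext
  have := a.2.1; have := a.2.2; have := b.2.1; have := b.2.2; have := c.2.1; have := c.2.2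
  simp only [luk]
  grind

theorem bsum_assoc (a b c : unitInterval) : bsum (bsum a b) c = bsum a (bsum b c) := by
  apply Subtype.ext
  have := a.2.1; have := a.2.2; have := b.2.1; have := b.2.2; have := c.2.1; have := c.2.2
  simp only [bsum]
  grind

theorem psum_assoc (a b c : unitInterval) : psum (psum a b) c = psum a (psum b c) := by
  simp only [psum, unitInterval.symm_symm, mul_assoc]

instance (μ : Mode) : Std.Commutative (Conf.disj μ) where
  comm c d := by
    cases μ <;>
      simp only [Conf.disj, luk_comm c.dLo, luk_comm c.dHi, bsum_comm c.bLo, bsum_comm c.bHi,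
        psum_comm c.bLo, psum_comm c.bHi, max_comm c.bLo, max_comm c.bHi, min_comm c.dLo,
        min_comm c.dHi, mul_comm c.dLo, mul_comm c.dHi]

instance (μ : Mode) : Std.Associative (Conf.disj μ) where
  assoc c d e := by
    cases μ <;>
      simp only [Conf.disj, luk_assoc, bsum_assoc, psum_assoc, max_assoc, min_assoc, mul_assoc]

/-! ### p-programs -/

/-- Terms of a function-free language: variables (indexed by `ℕ`) and constants. -/
inductive Term (Const : Type)
  | var (i : ℕ)
  | const (c : Const)

/-- Atoms with arguments in `τ`; `τ` is `Term Const`, or `Const` for ground atoms. -/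
@[ext]
structure Atom (Pred τ : Type) where
  pred : Pred
  args : List τ

/-- The p-rules: facts `A ←c`, which carry no conjunctive mode, and rules
`(A ←c B₁, …, Bₘ ; μ)` with `m ≥ 1` and conjunctive mode `μ`. The disjunctive mode of a
p-rule is that of its head predicate and is kept in the program. -/
inductive PRule (Pred τ : Type)
  | fact (head : Atom Pred τ) (c : Conf)
  | rule (head : Atom Pred τ) (c : Conf) (μ : Mode) (body : List (Atom Pred τ))

variable {Pred τ Const : Type}

namespace Term

def vars : Term Const → List ℕ
  | var i => [i]
  | const _ => []

def consts : Term Const → List Const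
  | var _ => []
  | const c => [c]

def subst (θ : ℕ → Const) : Term Const → Const
  | var i => θ i
  | const c => c

end Term

namespace Atom

def vars (A : Atom Pred (Term Const)) : List ℕ := A.args.flatMap Term.vars

def consts (A : Atom Pred (Term Const)) : List Const := A.args.flatMap Term.consts

def subst (θ : ℕ → Const) (A : Atom Pred (Term Const)) : Atom Pred Const :=
  ⟨A.pred, A.args.map (Term.subst θ)⟩

end Atom

namespace PRule

def head : PRule Pred τ → Atom Pred τ
  | fact A _ => A
  | rule A _ _ _ => A

def conf : PRule Pred τ → Conf
  | fact _ c => c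
  | rule _ c _ _ => c

def body : PRule Pred τ → List (Atom Pred τ)
  | fact _ _ => []
  | rule _ _ _ bs => bs

def IsFact : PRule Pred τ → Prop
  | fact _ _ => True
  | rule _ _ _ _ => False

def consts (r : PRule Pred (Term Const)) : List Const := (r.head :: r.body).flatMap Atom.consts

def subst (θ : ℕ → Const) : PRule Pred (Term Const) → PRule Pred Const
  | fact A c => fact (A.subst θ) c
  | rule A c μ bs => rule (A.subst θ) c μ (bs.map (Atom.subst θ))

/-- The confidence propagated to the head of a ground p-rule:
`c ∧_μ f B₁ ∧_μ ⋯ ∧_μ f Bₘ`. -/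
def ruleConf (f : Atom Pred τ → Conf) : PRule Pred τ → Conf
  | fact _ c => c
  | rule _ c μ bs => bs.foldl (fun x B => Conf.conj μ x (f B)) c

end PRule

/-- A p-program over the predicates `Pred` (with their arities) and constants taken from
`Const`: a finite set of range restricted p-rules with consistent confidence levels.
Giving one disjunctive mode per predicate says that p-rules defining the same predicate
have the same disjunctive mode. -/
structure PProgram (Pred Const : Type) (arity : Pred → ℕ) where
  rules : Finset (PRule Pred (Term Const))
  disj : Pred → Mode
  consistent : ∀ r ∈ rules, r.conf.Consistent
  arity_eq : ∀ r ∈ rules, ∀ A ∈ r.head :: r.body, A.args.length = arity A.pred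
  body_ne : ∀ r ∈ rules, r.IsFact ∨ r.body ≠ []
  range_restricted : ∀ r ∈ rules, ∀ x ∈ r.head.vars, ∃ B ∈ r.body, x ∈ B.vars

namespace PProgram

variable {arity : Pred → ℕ}

/-- The constants occurring in the program. -/
def consts [DecidableEq Const] (P : PProgram Pred Const arity) : Finset Const :=
  P.rules.biUnion fun r => r.consts.toFinset

/-- The database size: the number of constants occurring in the program. -/
def dbSize [DecidableEq Const] (P : PProgram Pred Const arity) : ℕ := P.consts.card

/-- The part of the program that is not data: its p-rules with nonempty body. -/
def properRules (P : PProgram Pred Const arity) : Finset (PRule Pred (Term Const)) := by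
  classical exact P.rules.filter fun r => ¬ r.IsFact

/-- The p-rules that are facts asserting the atom `A`. -/
def factsFor (P : PProgram Pred Const arity) (A : Atom Pred (Term Const)) :
    Finset (PRule Pred (Term Const)) := by
  classical exact P.rules.filter fun r => r.IsFact ∧ r.head = A

/-- `p` is defined by a rule whose body mentions `q`. -/
def DependsOn (P : PProgram Pred Const arity) (p q : Pred) : Prop :=
  ∃ r ∈ P.rules, r.head.pred = p ∧ ∃ B ∈ r.body, B.pred = q

/-- A predicate is recursive if it depends on itself, directly or indirectly. -/
def Recursive (P : PProgram Pred Const arity) (p : Pred) : Prop :=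
  Relation.TransGen P.DependsOn p p

section semantics

variable [DecidableEq Const] [Inhabited Const]

/-- The Herbrand universe: the constants occurring in the program, or one arbitrary
constant if there are none. -/
def herbrand (P : PProgram Pred Const arity) : Finset Const :=
  if P.consts = ∅ then {default} else P.consts

/-- The Herbrand base: the ground atoms over the Herbrand universe. -/
def base (P : PProgram Pred Const arity) : Set (Atom Pred Const) :=
  {A | A.args.length = arity A.pred ∧ ∀ c ∈ A.args, c ∈ P.herbrand}

/-- The Herbrand instantiation: the set of ground instances of the p-rules over the Herbrand
universe. -/
def ground (P : PProgram Pred Const arity) : Set (PRule Pred Const) :=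
  {g | ∃ r ∈ P.rules, ∃ θ : ℕ → Const, (∀ i, θ i ∈ P.herbrand) ∧ g = r.subst θ}

end semantics

end PProgram

theorem Atom.subst_congr {θ θ' : ℕ → Const} (A : Atom Pred (Term Const))
    (h : ∀ i ∈ A.vars, θ i = θ' i) : A.subst θ = A.subst θ' := by
  simp only [Atom.subst, Atom.mk.injEq, true_and]
  apply List.map_congr_left
  intro t ht
  cases t with
  | const c => rfl
  | var i => exact h i (List.mem_flatMap.2 ⟨_, ht, by simp [Term.vars]⟩)

theorem PRule.subst_congr {θ θ' : ℕ → Const} (r : PRule Pred (Term Const))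
    (h : ∀ A ∈ r.head :: r.body, ∀ i ∈ A.vars, θ i = θ' i) : r.subst θ = r.subst θ' := by
  cases r with
  | fact A c =>
    simp only [PRule.subst, A.subst_congr (h A (by simp [PRule.head]))]
  | rule A c μ bs =>
    simp only [PRule.subst, A.subst_congr (h A (by simp [PRule.head]))]
    congr 1
    apply List.map_congr_left
    intro B hB
    exact B.subst_congr (h B (by simp [PRule.body, hB]))

theorem PProgram.ground_finite {arity : Pred → ℕ} [DecidableEq Const] [Inhabited Const]
    (P : PProgram Pred Const arity) : P.ground.Finite := by
  have hne : P.herbrand.Nonempty := by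
    unfold PProgram.herbrand
    split_ifs with h
    · simp
    · exact Finset.nonempty_iff_ne_empty.2 h
  obtain ⟨a, ha⟩ := hne
  have key : ∀ r ∈ P.rules,
      {g | ∃ θ : ℕ → Const, (∀ i, θ i ∈ P.herbrand) ∧ g = PRule.subst θ r}.Finite := by
    intro r _
    obtain ⟨N, hN⟩ : ∃ N, ∀ A ∈ r.head :: r.body, ∀ i ∈ A.vars, i < N := by
      refine ⟨((r.head :: r.body).flatMap Atom.vars).sum + 1, fun A hA i hi => ?_⟩
      exact Nat.lt_succ_of_le (List.le_sum_of_mem (List.mem_flatMap.2 ⟨A, hA, hi⟩))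
    refine (Set.finite_range (fun t : Fin N → P.herbrand =>
      r.subst (fun i => if h : i < N then (t ⟨i, h⟩ : Const) else a))).subset ?_
    rintro g ⟨θ, hθ, rfl⟩
    refine ⟨fun i => ⟨θ i, hθ i⟩, ?_⟩
    apply PRule.subst_congr
    intro A hA i hi
    simp [hN A hA i hi]
  refine (P.rules.finite_toSet.biUnion key).subset ?_
  rintro g ⟨r, hr, θ, hθ, rfl⟩
  simp only [Set.mem_iUnion]
  exact ⟨r, hr, θ, hθ, rfl⟩

namespace PProgram

variable {arity : Pred → ℕ} [DecidableEq Const] [Inhabited Const]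

/-- Valuations, ordered pointwise by the truth order. -/
abbrev Valuation (P : PProgram Pred Const arity) : Type := P.base → Conf

/-- The valuation **false**. -/
def falseVal (P : PProgram Pred Const arity) : P.Valuation := fun _ => Conf.falsum

/-- The value of a valuation at a ground atom (atoms outside the Herbrand base, which do not
occur in the Herbrand instantiation, get the least value). -/
def value (P : PProgram Pred Const arity) (v : P.Valuation) (A : Atom Pred Const) : Conf := by
  classical exact if h : A ∈ P.base then v ⟨A, h⟩ else Conf.falsum

/-- The immediate consequence operator: the disjunction, in the mode of the predicate of `A`,
of the confidences propagated to `A` by the ground p-rules with head `A`. The least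
confidence level is the identity of every disjunction and the value of the empty one. -/
def immCons (P : PProgram Pred Const arity) (v : P.Valuation) : P.Valuation := by
  classical
  exact fun A =>
    (P.ground_finite.toFinset.filter fun g => g.head = A.1).fold
      (Conf.disj (P.disj A.1.pred)) Conf.falsum (PRule.ruleConf (P.value v))

end PProgram

/-! ### Unit-cost computations

The cost model: lists are linked lists; a test of equality of two symbols, a comparison of
two numbers, an arithmetic operation on two real numbers, and every visit of a list cell
cost one unit each. Each function below charges its own operations, once per recursive
call, and calls no function of unbounded cost that does not itself charge. -/

/-- The result of a computation together with the number of elementary operations used. -/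
structure Timed (α : Type) where
  val : α
  time : ℕ

namespace Timed

instance : Monad Timed where
  pure a := ⟨a, 0⟩
  bind x f := ⟨(f x.val).val, x.time + (f x.val).time⟩

/-- Charge `n` elementary operations. -/
def tick (n : ℕ) : Timed Unit := ⟨(), n⟩

end Timed

namespace Naive

open Timed

variable {α β : Type}

def append : List α → List α → Timed (List α)
  | [], k => do tick 1; return k
  | a :: l, k => do tick 1; let r ← append l k; return a :: r

def map (f : α → Timed β) : List α → Timed (List β)
  | [] => do tick 1; return []
  | a :: l => do tick 1; let b ← f a; let r ← map f l; return b :: r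

def flatMap (f : α → Timed (List β)) : List α → Timed (List β)
  | [] => do tick 1; return []
  | a :: l => do tick 1; let b ← f a; let r ← flatMap f l; append b r

/-- The `i`-th entry of a list. -/
def get (d : α) : List α → ℕ → Timed α
  | [], _ => do tick 1; return d
  | a :: _, 0 => do tick 1; return a
  | _ :: l, i + 1 => do tick 1; get d l i

/-- Equality of two symbols. -/
def symEq [DecidableEq α] (a b : α) : Timed Bool := do tick 1; return decide (a = b)

def listEq (eq : α → α → Timed Bool) : List α → List α → Timed Bool
  | [], [] => do tick 1; return true
  | a :: l, b :: k => do
    tick 1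
    let e ← eq a b
    if e then listEq eq l k else return false
  | _, _ => do tick 1; return false

def mem (eq : α → α → Timed Bool) (a : α) : List α → Timed Bool
  | [] => do tick 1; return false
  | b :: l => do
    tick 1
    let e ← eq a b
    if e then return true else mem eq a l

/-- Removal of repetitions. -/
def dedup (eq : α → α → Timed Bool) : List α → Timed (List α)
  | [] => do tick 1; return []
  | a :: l => do
    tick 1
    let r ← dedup eq l
    let e ← mem eq a r
    if e then return r else return a :: r

/-- All lists of length `k` with entries in a given list. -/
def tuples (cs : List α) : ℕ → Timed (List (List α))
  | 0 => do tick 1; return [[]]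
  | k + 1 => do
    tick 1
    let ts ← tuples cs k
    flatMap (fun c => map (fun t => do tick 1; return c :: t) ts) cs

/-- Four comparisons of real numbers. -/
def confEq (c d : Conf) : Timed Bool := by
  classical exact do tick 4; return decide (c = d)

/-- Each of the four bounds takes at most four operations on real numbers. -/
def conj (μ : Mode) (c d : Conf) : Timed Conf := do tick 16; return Conf.conj μ c d

/-- Each of the four bounds takes at most four operations on real numbers. -/
def disj (μ : Mode) (c d : Conf) : Timed Conf := do tick 16; return Conf.disj μ c d

def modeEq (μ ν : Mode) : Timed Bool := by
  classical exact do tick 1; return decide (μ = ν)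

section

variable [DecidableEq Pred] [DecidableEq Const]

def atomEq (A B : Atom Pred Const) : Timed Bool := do
  let e ← symEq A.pred B.pred
  if e then listEq symEq A.args B.args else return false

def ruleEq : PRule Pred Const → PRule Pred Const → Timed Bool
  | .fact A c, .fact B d => do
    tick 1
    let e ← atomEq A B
    if e then confEq c d else return false
  | .rule A c μ as, .rule B d ν bs => do
    tick 1
    let e ← atomEq A B
    let e₁ ← confEq c d
    let e₂ ← modeEq μ ν
    let e₃ ← listEq atomEq as bs
    return e && e₁ && e₂ && e₃
  | _, _ => do tick 1; return false

end

/-! #### Grounding -/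

def atomConsts (A : Atom Pred (Term Const)) : Timed (List Const) :=
  flatMap (fun t => do tick 1; return t.consts) A.args

def ruleConsts (r : PRule Pred (Term Const)) : Timed (List Const) := do
  tick 1
  flatMap atomConsts (r.head :: r.body)

def termVars (t : Term Const) : Timed (List ℕ) := do tick 1; return t.vars

def ruleVars (r : PRule Pred (Term Const)) : Timed (List ℕ) := do
  tick 1
  flatMap (fun A => flatMap termVars A.args) (r.head :: r.body)

/-- A strict upper bound of a list of numbers. -/
def bound : List ℕ → Timed ℕ
  | [] => do tick 1; return 0
  | i :: l => do tick 1; let b ← bound l; return max (i + 1) b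

def termSubst [Inhabited Const] (θ : List Const) : Term Const → Timed Const
  | .var i => do tick 1; get default θ i
  | .const c => do tick 1; return c

def atomSubst [Inhabited Const] (θ : List Const) (A : Atom Pred (Term Const)) :
    Timed (Atom Pred Const) := do
  tick 1
  let as ← map (termSubst θ) A.args
  return ⟨A.pred, as⟩

def ruleSubst [Inhabited Const] (θ : List Const) :
    PRule Pred (Term Const) → Timed (PRule Pred Const)
  | .fact A c => do
    tick 1
    let A' ← atomSubst θ A
    return .fact A' c
  | .rule A c μ bs => do
    tick 1
    let A' ← atomSubst θ A
    let bs' ← map (atomSubst θ) bs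
    return .rule A' c μ bs'

/-- The instances of a rule over a list of constants. -/
def instances [Inhabited Const] (cs : List Const) (r : PRule Pred (Term Const)) :
    Timed (List (PRule Pred Const)) := do
  let xs ← ruleVars r
  let k ← bound xs
  let θs ← tuples cs k
  map (fun θ => ruleSubst θ r) θs

/-- A valuation as a table: one entry per ground atom. -/
abbrev Table (Pred Const : Type) : Type := List (Atom Pred Const × Conf)

/-- The set-up phase: collect the constants, instantiate the p-rules, and build the table
of the valuation **false**. -/
def setup [DecidableEq Pred] [DecidableEq Const] [Inhabited Const] (arity : Pred → ℕ)
    (preds : List Pred) (rules : List (PRule Pred (Term Const))) :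
    Timed (List (PRule Pred Const) × Table Pred Const) := do
  let cs ← flatMap ruleConsts rules
  let cs' ← dedup symEq cs
  tick 1
  let univ := match cs' with
    | [] => [default]
    | c :: l => c :: l
  let gs ← flatMap (instances univ) rules
  let gs' ← dedup ruleEq gs
  let tab ← flatMap (fun p => do
    tick 1
    let ts ← tuples univ (arity p)
    map (fun t => do tick 1; return ((⟨p, t⟩ : Atom Pred Const), Conf.falsum)) ts) preds
  return (gs', tab)

/-! #### Iteration -/

section

variable [DecidableEq Pred] [DecidableEq Const]

def lookup (A : Atom Pred Const) : Table Pred Const → Timed Conf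
  | [] => do tick 1; return Conf.falsum
  | (B, c) :: tab => do
    tick 1
    let e ← atomEq A B
    if e then return c else lookup A tab

def bodyConf (tab : Table Pred Const) (μ : Mode) : Conf → List (Atom Pred Const) → Timed Conf
  | x, [] => do tick 1; return x
  | x, B :: bs => do
    tick 1
    let c ← lookup B tab
    let y ← conj μ x c
    bodyConf tab μ y bs

def ruleConf (tab : Table Pred Const) : PRule Pred Const → Timed Conf
  | .fact _ c => do tick 1; return c
  | .rule _ c μ bs => do tick 1; bodyConf tab μ c bs

/-- Combine the confidences of all derivations of `A`. -/
def atomConf (μ : Mode) (tab : Table Pred Const) (A : Atom Pred Const) :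
    List (PRule Pred Const) → Timed Conf
  | [] => do tick 1; return Conf.falsum
  | g :: gs => do
    tick 1
    let x ← atomConf μ tab A gs
    let e ← atomEq g.head A
    if e then
      let c ← ruleConf tab g
      disj μ c x
    else return x

/-- One iteration: recompute every entry from the previous table, and test whether anything
has changed. -/
def iteration (modes : Pred → Mode) (gs : List (PRule Pred Const)) (tab : Table Pred Const) :
    Timed (Table Pred Const × Bool) := do
  let tab' ← map (fun e => do
    tick 1
    let c ← atomConf (modes e.1.pred) tab e.1 gs
    return (e.1, c)) tab
  let same ← listEq (fun e e' => confEq e.2 e'.2) tab tab'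
  return (tab', same)

/-- `Loop modes gs tab costs out`: iterating from `tab` until nothing changes halts with the
table `out`; `costs` lists the numbers of elementary operations of the successive
iterations, the last of which verifies that nothing has changed. -/
inductive Loop (modes : Pred → Mode) (gs : List (PRule Pred Const)) :
    Table Pred Const → List ℕ → Table Pred Const → Prop
  | halt (tab : Table Pred Const) (h : (iteration modes gs tab).val.2 = true) :
      Loop modes gs tab [(iteration modes gs tab).time] (iteration modes gs tab).val.1
  | next (tab : Table Pred Const) (costs : List ℕ) (out : Table Pred Const)
      (h : (iteration modes gs tab).val.2 = false)
      (h' : Loop modes gs (iteration modes gs tab).val.1 costs out) :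
      Loop modes gs tab ((iteration modes gs tab).time :: costs) out

/-- Naive bottom-up evaluation of the listed program halts after `costs.length` iterations
with the table `out`, using `s` elementary operations for the set-up and `costs` for the
iterations. -/
def Halts [Inhabited Const] (arity : Pred → ℕ) (modes : Pred → Mode) (preds : List Pred)
    (rules : List (PRule Pred (Term Const))) (s : ℕ) (costs : List ℕ)
    (out : Table Pred Const) : Prop :=
  s = (setup arity preds rules).time ∧
    Loop modes (setup arity preds rules).val.1 (setup arity preds rules).val.2 costs out

end

end Naive

end PDatalog

end

/-!
The operator `T_P` is monotone, so its iterates from **false** increase, and each of the four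
bounds of a confidence level evolves without regard to the other three. If a bound at a ground
atom rises from stage `k + 1` to stage `k + 2`, then it has risen one stage earlier at an atom in
the body of one of the ground rules for that atom. Where the head predicate is recursive, the
disjunction is a maximum, hence attained by a single rule, and no conjunction exceeds a conjunct:
the risen value is at most the one it is traced back to. A chain of such rises therefore never
returns to an atom: all predicates on the way would be recursive, so the later value would be at
most an earlier one at the same atom. So a rise at stage `k` traces back through `k + 1` distinct
atoms, nothing changes from stage `|B_P|` on, and the number of iterations is at most
`|B_P| + 1`. Both `|B_P|` and the number of ground instances are polynomial in the number of
constants, the arities and the numbers of variables per rule being bounded.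
-/

/-! ### Confidence levels in the truth order -/

namespace PDatalog

section UnitInterval

variable {a a' b b' : unitInterval}

theorem luk_le_luk (ha : a ≤ a') (hb : b ≤ b') : luk a b ≤ luk a' b' :=
  max_le_max le_rfl (sub_le_sub_right (add_le_add (α := ℝ) ha hb) 1)

theorem bsum_le_bsum (ha : a ≤ a') (hb : b ≤ b') : bsum a b ≤ bsum a' b' :=
  min_le_min le_rfl (add_le_add (α := ℝ) ha hb)

theorem psum_le_psum (ha : a ≤ a') (hb : b ≤ b') : psum a b ≤ psum a' b' :=
  unitInterval.strictAnti_symm.antitone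
    (mul_le_mul' (unitInterval.strictAnti_symm.antitone ha)
      (unitInterval.strictAnti_symm.antitone hb))

theorem luk_le_left (a b : unitInterval) : luk a b ≤ a :=
  max_le a.2.1 (by linarith [b.2.2])

theorem left_le_bsum (a b : unitInterval) : a ≤ bsum a b :=
  le_min a.2.2 (le_add_of_nonneg_right b.2.1)

theorem left_le_psum (a b : unitInterval) : a ≤ psum a b := by
  have h : unitInterval.symm a * unitInterval.symm b ≤ unitInterval.symm a :=
    mul_le_of_le_one_right' (unitInterval.symm b).2.2
  simpa only [psum, unitInterval.symm_symm] using unitInterval.strictAnti_symm.antitone h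

end UnitInterval

namespace Conf

instance : OrderBot Conf where
  bot := falsum
  bot_le c := ⟨c.bLo.2.1, c.bHi.2.1, c.dLo.2.2, c.dHi.2.2⟩

theorem conj_le_conj (μ : Mode) {c c' d d' : Conf} (hc : c ≤ c') (hd : d ≤ d') :
    conj μ c d ≤ conj μ c' d' := by
  obtain ⟨hc₁, hc₂, hc₃, hc₄⟩ := hc
  obtain ⟨hd₁, hd₂, hd₃, hd₄⟩ := hd
  cases μ
  case ig =>
    exact ⟨luk_le_luk hc₁ hd₁, min_le_min hc₂ hd₂, max_le_max hc₃ hd₃, bsum_le_bsum hc₄ hd₄⟩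
  case ind =>
    exact ⟨mul_le_mul' hc₁ hd₁, mul_le_mul' hc₂ hd₂, psum_le_psum hc₃ hd₃, psum_le_psum hc₄ hd₄⟩
  case pc => exact ⟨min_le_min hc₁ hd₁, min_le_min hc₂ hd₂, max_le_max hc₃ hd₃, max_le_max hc₄ hd₄⟩
  case nc =>
    exact ⟨luk_le_luk hc₁ hd₁, luk_le_luk hc₂ hd₂, bsum_le_bsum hc₃ hd₃, bsum_le_bsum hc₄ hd₄⟩
  case me => exact ⟨le_rfl, le_rfl, bsum_le_bsum hc₃ hd₃, bsum_le_bsum hc₄ hd₄⟩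

theorem disj_le_disj (μ : Mode) {c c' d d' : Conf} (hc : c ≤ c') (hd : d ≤ d') :
    disj μ c d ≤ disj μ c' d' := by
  obtain ⟨hc₁, hc₂, hc₃, hc₄⟩ := hc
  obtain ⟨hd₁, hd₂, hd₃, hd₄⟩ := hd
  cases μ
  case ig =>
    exact ⟨max_le_max hc₁ hd₁, bsum_le_bsum hc₂ hd₂, luk_le_luk hc₃ hd₃, min_le_min hc₄ hd₄⟩
  case ind =>
    exact ⟨psum_le_psum hc₁ hd₁, psum_le_psum hc₂ hd₂, mul_le_mul' hc₃ hd₃, mul_le_mul' hc₄ hd₄⟩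
  case pc => exact ⟨max_le_max hc₁ hd₁, max_le_max hc₂ hd₂, min_le_min hc₃ hd₃, min_le_min hc₄ hd₄⟩
  all_goals
    exact ⟨bsum_le_bsum hc₁ hd₁, bsum_le_bsum hc₂ hd₂, luk_le_luk hc₃ hd₃, luk_le_luk hc₄ hd₄⟩

theorem conj_le_left (μ : Mode) (c d : Conf) : conj μ c d ≤ c := by
  cases μ
  case ig => exact ⟨luk_le_left _ _, min_le_left _ _, le_max_left _ _, left_le_bsum _ _⟩
  case ind =>
    exact ⟨mul_le_of_le_one_right' d.bLo.2.2, mul_le_of_le_one_right' d.bHi.2.2,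
      left_le_psum _ _, left_le_psum _ _⟩
  case pc => exact ⟨min_le_left _ _, min_le_left _ _, le_max_left _ _, le_max_left _ _⟩
  case nc => exact ⟨luk_le_left _ _, luk_le_left _ _, left_le_bsum _ _, left_le_bsum _ _⟩
  case me => exact ⟨c.bLo.2.1, c.bHi.2.1, left_le_bsum _ _, left_le_bsum _ _⟩

theorem conj_comm (μ : Mode) (c d : Conf) : conj μ c d = conj μ d c := by
  cases μ <;>
    simp only [conj, luk_comm c.bLo, luk_comm c.bHi, bsum_comm c.dLo, bsum_comm c.dHi,
      psum_comm c.dLo, psum_comm c.dHi, min_comm c.bLo, min_comm c.bHi, max_comm c.dLo,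
      max_comm c.dHi, mul_comm c.bLo, mul_comm c.bHi]

theorem conj_le_right (μ : Mode) (c d : Conf) : conj μ c d ≤ d :=
  conj_comm μ c d ▸ conj_le_left μ d c

/-- A coordinate of confidence levels on which every connective acts by itself and which is
monotone in the truth order: one of the four bounds, those of the doubt interval reversed. -/
structure IsCoord (π : Conf → unitInterval) : Prop where
  monotone : Monotone π
  conj_congr {c c' d d' : Conf} (μ : Mode) (hc : π c = π c') (hd : π d = π d') :
    π (conj μ c d) = π (conj μ c' d')
  disj_congr {c c' d d' : Conf} (μ : Mode) (hc : π c = π c') (hd : π d = π d') :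
    π (disj μ c d) = π (disj μ c' d')
  disj_pc (c d : Conf) : π (disj .pc c d) = max (π c) (π d)

theorem isCoord_bLo : IsCoord bLo where
  monotone _ _ h := h.1
  conj_congr μ hc hd := by cases μ <;> simp only [conj, hc, hd]
  disj_congr μ hc hd := by cases μ <;> simp only [disj, hc, hd]
  disj_pc _ _ := rfl

theorem isCoord_bHi : IsCoord bHi where
  monotone _ _ h := h.2.1
  conj_congr μ hc hd := by cases μ <;> simp only [conj, hc, hd]
  disj_congr μ hc hd := by cases μ <;> simp only [disj, hc, hd]
  disj_pc _ _ := rfl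

theorem isCoord_symm_dLo : IsCoord fun c => unitInterval.symm c.dLo where
  monotone _ _ h := unitInterval.strictAnti_symm.antitone h.2.2.1
  conj_congr μ hc hd := by
    rw [unitInterval.symm_inj] at hc hd ⊢
    cases μ <;> simp only [conj, hc, hd]
  disj_congr μ hc hd := by
    rw [unitInterval.symm_inj] at hc hd ⊢
    cases μ <;> simp only [disj, hc, hd]
  disj_pc _ _ := unitInterval.strictAnti_symm.antitone.map_min

theorem isCoord_symm_dHi : IsCoord fun c => unitInterval.symm c.dHi where
  monotone _ _ h := unitInterval.strictAnti_symm.antitone h.2.2.2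
  conj_congr μ hc hd := by
    rw [unitInterval.symm_inj] at hc hd ⊢
    cases μ <;> simp only [conj, hc, hd]
  disj_congr μ hc hd := by
    rw [unitInterval.symm_inj] at hc hd ⊢
    cases μ <;> simp only [disj, hc, hd]
  disj_pc _ _ := unitInterval.strictAnti_symm.antitone.map_min

theorem ext_isCoord {c d : Conf} (h : ∀ π, IsCoord π → π c = π d) : c = d :=
  Conf.ext (h _ isCoord_bLo) (h _ isCoord_bHi)
    (unitInterval.symm_inj.1 (h _ isCoord_symm_dLo))
    (unitInterval.symm_inj.1 (h _ isCoord_symm_dHi))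

end Conf

section Fold

variable {α : Type*}

theorem fold_rel {β γ : Type*} {op : β → β → β} {op' : γ → γ → γ}
    [Std.Commutative op] [Std.Associative op] [Std.Commutative op'] [Std.Associative op']
    {r : β → γ → Prop} (hop : ∀ ⦃b b' c c'⦄, r b c → r b' c' → r (op b b') (op' c c'))
    {b : β} {c : γ} (hbc : r b c) {f : α → β} {g : α → γ} {s : Finset α}
    (h : ∀ a ∈ s, r (f a) (g a)) : r (s.fold op b f) (s.fold op' c g) := by
  classical
  induction s using Finset.induction with
  | empty => simpa using hbc
  | insert a s ha ih =>
    rw [Finset.fold_insert ha, Finset.fold_insert ha]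
    exact hop (h a (Finset.mem_insert_self a s))
      (ih fun x hx => h x (Finset.mem_insert_of_mem hx))

namespace Conf

variable {f g : α → Conf} {s : Finset α} {b : Conf}

theorem fold_disj_le_fold_disj (μ : Mode) (h : ∀ a ∈ s, f a ≤ g a) :
    s.fold (disj μ) b f ≤ s.fold (disj μ) b g :=
  fold_rel (fun _ _ _ _ => disj_le_disj μ) le_rfl h

namespace IsCoord

variable {π : Conf → unitInterval} (hπ : IsCoord π)

include hπ

theorem fold_disj_pc : π (s.fold (disj .pc) b f) = s.fold max (π b) fun a => π (f a) :=
  (Finset.fold_hom hπ.disj_pc).symm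

theorem exists_ne_of_fold_disj_lt {μ : Mode}
    (h : π (s.fold (disj μ) b f) < π (s.fold (disj μ) b g)) :
    ∃ a ∈ s, π (f a) ≠ π (g a) ∧ (μ = .pc → π (s.fold (disj μ) b g) ≤ π (g a)) := by
  by_cases hμ : μ = .pc
  · subst hμ
    have hb : π b ≤ π (s.fold (disj .pc) b f) := by
      rw [hπ.fold_disj_pc]
      exact (Finset.le_fold_max _).2 (.inl le_rfl)
    have hf : ∀ a ∈ s, π (f a) ≤ π (s.fold (disj .pc) b f) := fun a ha => by
      rw [hπ.fold_disj_pc]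
      exact (Finset.le_fold_max _).2 (.inr ⟨a, ha, le_rfl⟩)
    obtain hgb | ⟨a, ha, hga⟩ := (Finset.le_fold_max _).1 (hπ.fold_disj_pc (s := s) (f := g)).le
    · exact absurd (h.trans_le hgb) hb.not_gt
    · exact ⟨a, ha, ((hf a ha).trans_lt (h.trans_le hga)).ne, fun _ => hga⟩
  · by_contra! hne
    refine h.ne (fold_rel (r := fun c d => π c = π d) (fun _ _ _ _ => hπ.disj_congr μ) rfl ?_)
    exact fun a ha => by_contra fun hfg => hμ (hne a ha hfg).1

end IsCoord

end Conf

end Fold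

end PDatalog

/-! ### The stages of the least fixpoint -/

namespace PDatalog

variable {Pred τ Const : Type}

section RuleConf

theorem foldl_conj_le (μ : Mode) (f : Atom Pred τ → Conf) (bs : List (Atom Pred τ)) (c : Conf) :
    bs.foldl (fun x B => Conf.conj μ x (f B)) c ≤ c := by
  induction bs generalizing c with
  | nil => exact le_rfl
  | cons B bs ih => exact (ih _).trans (Conf.conj_le_left μ c (f B))

theorem foldl_conj_le_of_mem (μ : Mode) (f : Atom Pred τ → Conf) {bs : List (Atom Pred τ)}
    {B : Atom Pred τ} (hB : B ∈ bs) (c : Conf) :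
    bs.foldl (fun x B => Conf.conj μ x (f B)) c ≤ f B := by
  induction bs generalizing c with
  | nil => cases hB
  | cons D bs ih =>
    obtain rfl | hB := List.mem_cons.1 hB
    · exact (foldl_conj_le μ f bs _).trans (Conf.conj_le_right μ c (f B))
    · exact ih hB _

namespace PRule

variable {g : PRule Pred τ} {f f' : Atom Pred τ → Conf}

theorem ruleConf_rel {r : Conf → Conf → Prop} (hr : ∀ c, r c c)
    (hconj : ∀ μ ⦃c c' d d'⦄, r c c' → r d d' → r (Conf.conj μ c d) (Conf.conj μ c' d'))
    (h : ∀ B ∈ g.body, r (f B) (f' B)) : r (g.ruleConf f) (g.ruleConf f') := by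
  cases g with
  | fact A c => exact hr c
  | rule A c μ bs => exact List.foldl_rel (hr c) fun B hB _ _ hx => hconj μ hx (h B hB)

theorem ruleConf_le_ruleConf (h : ∀ B ∈ g.body, f B ≤ f' B) : g.ruleConf f ≤ g.ruleConf f' :=
  ruleConf_rel (r := (· ≤ ·)) (fun _ => le_rfl) (fun μ _ _ _ _ => Conf.conj_le_conj μ) h

theorem ruleConf_le_of_mem {B : Atom Pred τ} (hB : B ∈ g.body) : g.ruleConf f ≤ f B := by
  cases g with
  | fact A c => cases hB
  | rule A c μ bs => exact foldl_conj_le_of_mem μ f hB c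

@[simp]
theorem head_subst (θ : ℕ → Const) (r : PRule Pred (Term Const)) :
    (r.subst θ).head = r.head.subst θ := by cases r <;> rfl

@[simp]
theorem body_subst (θ : ℕ → Const) (r : PRule Pred (Term Const)) :
    (r.subst θ).body = r.body.map (Atom.subst θ) := by cases r <;> rfl

end PRule

theorem Conf.IsCoord.exists_ne_of_ruleConf_ne {π : Conf → unitInterval}
    (hπ : Conf.IsCoord π)
    {g : PRule Pred τ} {f f' : Atom Pred τ → Conf} (h : π (g.ruleConf f) ≠ π (g.ruleConf f')) :
    ∃ B ∈ g.body, π (f B) ≠ π (f' B) := by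
  by_contra! heq
  exact h (PRule.ruleConf_rel (r := fun c d => π c = π d) (fun _ => rfl)
    (fun μ _ _ _ _ => hπ.conj_congr μ) heq)

end RuleConf

theorem isLeast_fixedPoints_iterate_bot {α : Type*} [PartialOrder α] [OrderBot α] {f : α → α}
    (hf : Monotone f) {k : ℕ} (hk : f^[k + 1] ⊥ = f^[k] ⊥) :
    IsLeast {u | f u = u} (f^[k] ⊥) := by
  refine ⟨(Function.iterate_succ_apply' f k ⊥).symm.trans hk, fun u hu => ?_⟩
  calc f^[k] ⊥ ≤ f^[k] u := hf.iterate k bot_le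
    _ = u := Function.IsFixedPt.iterate hu k

namespace PProgram

variable {arity : Pred → ℕ} [DecidableEq Const] [Inhabited Const] {P : PProgram Pred Const arity}

theorem value_of_mem (v : P.Valuation) {A : Atom Pred Const} (hA : A ∈ P.base) :
    P.value v A = v ⟨A, hA⟩ := dif_pos hA

theorem value_of_notMem (v : P.Valuation) {A : Atom Pred Const} (hA : A ∉ P.base) :
    P.value v A = Conf.falsum := dif_neg hA

theorem value_mono {v w : P.Valuation} (h : v ≤ w) (A : Atom Pred Const) :
    P.value v A ≤ P.value w A := by
  by_cases hA : A ∈ P.base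
  · simpa only [value_of_mem _ hA] using h ⟨A, hA⟩
  · simp only [value_of_notMem _ hA, le_rfl]

theorem immCons_mono (P : PProgram Pred Const arity) : Monotone P.immCons := fun _ _ h _ =>
  Conf.fold_disj_le_fold_disj _ fun _ _ => PRule.ruleConf_le_ruleConf fun B _ => value_mono h B

theorem dependsOn_of_mem_body {g : PRule Pred Const} (hg : g ∈ P.ground) {B : Atom Pred Const}
    (hB : B ∈ g.body) : P.DependsOn g.head.pred B.pred := by
  obtain ⟨r, hr, θ, -, rfl⟩ := hg
  rw [PRule.body_subst] at hB
  obtain ⟨D, hD, rfl⟩ := List.mem_map.1 hB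
  exact ⟨r, hr, by rw [PRule.head_subst]; rfl, D, hD, rfl⟩

theorem exists_ne_of_immCons_lt {π : Conf → unitInterval} (hπ : Conf.IsCoord π)
    {v w : P.Valuation} {A : P.base} (h : π (P.immCons v A) < π (P.immCons w A)) :
    ∃ B : P.base, P.DependsOn A.1.pred B.1.pred ∧ π (v B) ≠ π (w B) ∧
      (P.disj A.1.pred = .pc → π (P.immCons w A) ≤ π (w B)) := by
  classical
  obtain ⟨g, hg, hne, hpc⟩ := hπ.exists_ne_of_fold_disj_lt h
  obtain ⟨hg, hgA⟩ := Finset.mem_filter.1 hg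
  obtain ⟨B, hB, hvw⟩ := hπ.exists_ne_of_ruleConf_ne hne
  have hBase : B ∈ P.base := by
    by_contra hB'
    simp only [value_of_notMem _ hB', ne_eq, not_true_eq_false] at hvw
  have hwB : g.ruleConf (P.value w) ≤ w ⟨B, hBase⟩ :=
    value_of_mem w hBase ▸ PRule.ruleConf_le_of_mem hB
  rw [value_of_mem _ hBase, value_of_mem _ hBase] at hvw
  exact ⟨⟨B, hBase⟩, hgA ▸ dependsOn_of_mem_body (P.ground_finite.mem_toFinset.1 hg) hB, hvw,
    fun hd => (hpc hd).trans (hπ.monotone hwB)⟩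

variable (P) in
/-- The `k`-th iterate of the immediate consequence operator from the valuation **false**. -/
noncomputable def stage (k : ℕ) : P.Valuation := P.immCons^[k] P.falseVal

theorem stage_succ (k : ℕ) : P.stage (k + 1) = P.immCons (P.stage k) :=
  Function.iterate_succ_apply' _ _ _

theorem stage_mono : Monotone P.stage :=
  P.immCons_mono.monotone_iterate_of_le_map fun _ => bot_le

/-- The coordinate `π` of the value at the ground atom `x.2` increases from stage `x.1` to the
next. -/
def RisesAt (π : Conf → unitInterval) (x : ℕ × P.base) : Prop :=
  π (P.stage x.1 x.2) < π (P.stage (x.1 + 1) x.2)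

/-- The rise `x` of the coordinate `π` is caused by the rise `y`, one stage earlier, at an atom
that the atom of `x` depends on. -/
structure TracesTo (π : Conf → unitInterval) (x y : ℕ × P.base) : Prop where
  rises : RisesAt π y
  stage_eq : x.1 = y.1 + 1
  dependsOn : P.DependsOn x.2.1.pred y.2.1.pred
  le_of_pc : P.disj x.2.1.pred = .pc →
    π (P.stage (x.1 + 1) x.2) ≤ π (P.stage (y.1 + 1) y.2)

section Trace

variable {π : Conf → unitInterval} {x y : ℕ × P.base}

theorem exists_tracesTo (hπ : Conf.IsCoord π) {k : ℕ} {A : P.base} (h : RisesAt π (k + 1, A)) :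
    ∃ B, TracesTo π (k + 1, A) (k, B) := by
  have hlt : π (P.immCons (P.stage k) A) < π (P.immCons (P.stage (k + 1)) A) := by
    simpa only [RisesAt, stage_succ] using h
  obtain ⟨B, hdep, hne, hpc⟩ := exists_ne_of_immCons_lt hπ hlt
  refine ⟨B, (hπ.monotone (stage_mono k.le_succ B)).lt_of_ne hne, rfl, hdep, fun hd => ?_⟩
  simpa only [stage_succ] using hpc hd

theorem dependsOn_of_tracesTo (h : Relation.TransGen (TracesTo π) x y) :
    Relation.TransGen P.DependsOn x.2.1.pred y.2.1.pred :=
  h.lift (fun z => z.2.1.pred) fun _ _ h => h.dependsOn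

theorem stage_lt_of_tracesTo (h : Relation.TransGen (TracesTo π) x y) : y.1 < x.1 := by
  induction h with
  | single h => exact h.stage_eq ▸ Nat.lt_succ_self _
  | tail _ h ih => exact (h.stage_eq ▸ Nat.lt_succ_self _ : _ < _).trans ih

theorem le_of_tracesTo_of_dependsOn (hrec : ∀ p, P.Recursive p → P.disj p = .pc)
    (h : Relation.TransGen (TracesTo π) x y)
    (hyx : Relation.ReflTransGen P.DependsOn y.2.1.pred x.2.1.pred) :
    π (P.stage (x.1 + 1) x.2) ≤ π (P.stage (y.1 + 1) y.2) := by
  induction h using Relation.TransGen.head_induction_on with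
  | single h => exact h.le_of_pc (hrec _ (.head' h.dependsOn hyx))
  | head h hzy ih =>
    have hxy := (dependsOn_of_tracesTo hzy).head h.dependsOn
    exact (h.le_of_pc (hrec _ (hxy.trans_left hyx))).trans (ih (hyx.tail h.dependsOn))

theorem not_tracesTo_same_atom (hπ : Conf.IsCoord π) (hrec : ∀ p, P.Recursive p → P.disj p = .pc)
    {A : P.base} {k i : ℕ} (hA : RisesAt π (k, A)) :
    ¬ Relation.TransGen (TracesTo π) (k, A) (i, A) := fun h => by
  have hle : π (P.stage (k + 1) A) ≤ π (P.stage (i + 1) A) :=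
    le_of_tracesTo_of_dependsOn hrec h .refl
  exact (hA.trans_le hle).not_ge (hπ.monotone (stage_mono (stage_lt_of_tracesTo h) A))

theorem exists_card_eq_of_risesAt (hπ : Conf.IsCoord π)
    (hrec : ∀ p, P.Recursive p → P.disj p = .pc) {k : ℕ} {A : P.base} (h : RisesAt π (k, A)) :
    ∃ S : Finset P.base, S.card = k + 1 ∧
      ∀ B ∈ S, ∃ i, Relation.ReflTransGen (TracesTo π) (k, A) (i, B) := by
  classical
  induction k generalizing A with
  | zero => exact ⟨{A}, rfl, fun B hB => ⟨0, Finset.mem_singleton.1 hB ▸ .refl⟩⟩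
  | succ k ih =>
    obtain ⟨B, hAB⟩ := exists_tracesTo hπ h
    obtain ⟨S, hcard, hS⟩ := ih hAB.rises
    have hA : A ∉ S := fun hAS =>
      let ⟨_, hBA⟩ := hS A hAS
      not_tracesTo_same_atom hπ hrec h (.head' hAB hBA)
    refine ⟨insert A S, by rw [Finset.card_insert_of_notMem hA, hcard], fun D hD => ?_⟩
    obtain rfl | hD := Finset.mem_insert.1 hD
    · exact ⟨k + 1, .refl⟩
    · exact (hS D hD).imp fun _ => .head hAB

end Trace

theorem stage_ncard_base (hrec : ∀ p, P.Recursive p → P.disj p = .pc) (hfin : P.base.Finite) :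
    P.stage (P.base.ncard + 1) = P.stage P.base.ncard := by
  have := hfin.fintype
  refine funext fun A => Conf.ext_isCoord fun π hπ => ?_
  by_contra hne
  obtain ⟨S, hcard, -⟩ := exists_card_eq_of_risesAt hπ hrec
    ((hπ.monotone (stage_mono (Nat.le_succ _) A)).lt_of_ne' hne)
  have hle : S.card ≤ P.base.ncard := S.card_le_univ.trans_eq Nat.card_eq_fintype_card.symm
  exact Nat.not_succ_le_self _ (hcard ▸ hle)

theorem isLeast_stage (hfin : P.base.Finite) (hrec : ∀ p, P.Recursive p → P.disj p = .pc) :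
    IsLeast {u | P.immCons u = u} (P.stage P.base.ncard) :=
  isLeast_fixedPoints_iterate_bot P.immCons_mono (stage_ncard_base hrec hfin)

end PProgram

end PDatalog

/-! ### Unit-cost list algorithms -/

namespace PDatalog

namespace Timed

variable {α β : Type}

@[simp]
theorem val_pure (a : α) : (pure a : Timed α).val = a := rfl

@[simp]
theorem time_pure (a : α) : (pure a : Timed α).time = 0 := rfl

@[simp]
theorem val_bind (x : Timed α) (f : α → Timed β) : (x >>= f).val = (f x.val).val := rfl

@[simp]
theorem time_bind (x : Timed α) (f : α → Timed β) :
    (x >>= f).time = x.time + (f x.val).time := rfl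

@[simp]
theorem time_tick (n : ℕ) : (tick n).time = n := rfl

end Timed

namespace Naive

section ListAlgorithms

variable {α β : Type} {l : List α} {n t s : ℕ}

@[simp]
theorem val_append (l k : List α) : (append l k).val = l ++ k := by
  induction l with
  | nil => rfl
  | cons a l ih => simp only [append, Timed.val_bind, Timed.val_pure, ih, List.cons_append]

@[simp]
theorem time_append (l k : List α) : (append l k).time = l.length + 1 := by
  induction l with
  | nil => rfl
  | cons a l ih =>
    simp only [append, Timed.time_bind, Timed.time_tick, Timed.time_pure, ih, List.length_cons]
    omega

@[simp]
theorem val_map (f : α → Timed β) (l : List α) : (map f l).val = l.map fun a => (f a).val := by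
  induction l with
  | nil => rfl
  | cons a l ih => simp only [map, Timed.val_bind, Timed.val_pure, ih, List.map_cons]

theorem time_map_le {f : α → Timed β} (hl : l.length ≤ n) (ht : ∀ a ∈ l, (f a).time ≤ t) :
    (map f l).time ≤ (n + 1) * (t + 1) := by
  refine le_trans ?_ (Nat.mul_le_mul_right (t + 1) (Nat.succ_le_succ hl))
  clear hl
  induction l with
  | nil => simp [map]
  | cons a l ih =>
    obtain ⟨ha, hl⟩ := List.forall_mem_cons.1 ht
    have := ih hl
    simp only [map, Timed.time_bind, Timed.time_tick, Timed.time_pure, List.length_cons]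
    linarith

@[simp]
theorem val_flatMap (f : α → Timed (List β)) (l : List α) :
    (flatMap f l).val = l.flatMap fun a => (f a).val := by
  induction l with
  | nil => rfl
  | cons a l ih => simp only [flatMap, Timed.val_bind, val_append, ih, List.flatMap_cons]

theorem time_flatMap_le {f : α → Timed (List β)} (hl : l.length ≤ n)
    (ht : ∀ a ∈ l, (f a).time ≤ t) (hs : ∀ a ∈ l, (f a).val.length ≤ s) :
    (flatMap f l).time ≤ (n + 1) * (t + s + 2) := by
  refine le_trans ?_ (Nat.mul_le_mul_right (t + s + 2) (Nat.succ_le_succ hl))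
  clear hl
  induction l with
  | nil => simp [flatMap]
  | cons a l ih =>
    obtain ⟨hta, htl⟩ := List.forall_mem_cons.1 ht
    obtain ⟨hsa, hsl⟩ := List.forall_mem_cons.1 hs
    have := ih htl hsl
    simp only [flatMap, Timed.time_bind, Timed.time_tick, time_append, List.length_cons]
    linarith

theorem length_flatMap_le {f : α → List β} (hl : l.length ≤ n) (hs : ∀ a ∈ l, (f a).length ≤ s) :
    (l.flatMap f).length ≤ n * s := by
  rw [List.length_flatMap]
  refine (List.sum_le_card_nsmul _ s (by simpa using hs)).trans ?_
  simpa using Nat.mul_le_mul_right s hl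

@[simp]
theorem val_get (d : α) (l : List α) (i : ℕ) : (get d l i).val = l.getD i d := by
  induction l generalizing i with
  | nil => rfl
  | cons a l ih =>
    cases i with
    | zero => rfl
    | succ i => exact ih i

theorem time_get_le (d : α) (i : ℕ) (hl : l.length ≤ n) : (get d l i).time ≤ n + 1 := by
  refine le_trans ?_ (Nat.succ_le_succ hl)
  clear hl
  induction l generalizing i with
  | nil => simp [get]
  | cons a l ih =>
    cases i with
    | zero => simp [get]
    | succ i =>
      have := ih i
      simp only [get, Timed.time_bind, Timed.time_tick, List.length_cons]
      omega

variable {eq : α → α → Timed Bool}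

theorem time_listEq_le (k : List α) (hl : l.length ≤ n) (ht : ∀ a ∈ l, ∀ b, (eq a b).time ≤ t) :
    (listEq eq l k).time ≤ (n + 1) * (t + 1) := by
  refine le_trans ?_ (Nat.mul_le_mul_right (t + 1) (Nat.succ_le_succ hl))
  clear hl
  induction l generalizing k with
  | nil => cases k <;> simp [listEq]
  | cons a l ih =>
    obtain ⟨ha, hl⟩ := List.forall_mem_cons.1 ht
    cases k with
    | nil =>
      simp only [listEq, Timed.time_bind, Timed.time_tick, Timed.time_pure]
      exact Nat.mul_pos (Nat.succ_pos _) t.succ_pos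
    | cons b k =>
      have := ha b
      have := ih k hl
      simp only [listEq, Timed.time_bind, Timed.time_tick, List.length_cons]
      split
      · linarith
      · rw [Timed.time_pure]
        nlinarith

theorem time_mem_le (a : α) (hl : l.length ≤ n) (ht : ∀ b ∈ l, (eq a b).time ≤ t) :
    (mem eq a l).time ≤ (n + 1) * (t + 1) := by
  refine le_trans ?_ (Nat.mul_le_mul_right (t + 1) (Nat.succ_le_succ hl))
  clear hl
  induction l with
  | nil => simp [mem]
  | cons b l ih =>
    obtain ⟨hb, hl⟩ := List.forall_mem_cons.1 ht
    have := ih hl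
    simp only [mem, Timed.time_bind, Timed.time_tick, List.length_cons]
    split
    · rw [Timed.time_pure]
      nlinarith
    · linarith

theorem val_dedup_cons (a : α) (l : List α) :
    (dedup eq (a :: l)).val =
      if (mem eq a (dedup eq l).val).val then (dedup eq l).val else a :: (dedup eq l).val := by
  simp only [dedup, Timed.val_bind]
  split <;> rfl

theorem dedup_sublist (eq : α → α → Timed Bool) (l : List α) : (dedup eq l).val.Sublist l := by
  induction l with
  | nil => exact .slnil
  | cons a l ih =>
    rw [val_dedup_cons]
    split
    · exact ih.cons a
    · exact ih.cons_cons a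

theorem time_dedup_le (hl : l.length ≤ n) (ht : ∀ a ∈ l, ∀ b, (eq a b).time ≤ t) :
    (dedup eq l).time ≤ (n + 1) ^ 2 * (t + 1) := by
  refine le_trans ?_ (Nat.mul_le_mul_right (t + 1) (Nat.pow_le_pow_left (Nat.succ_le_succ hl) 2))
  clear hl
  induction l with
  | nil => simp [dedup]
  | cons a l ih =>
    obtain ⟨ha, hl⟩ := List.forall_mem_cons.1 ht
    have hmem : (mem eq a (dedup eq l).val).time ≤ (l.length + 1) * (t + 1) :=
      time_mem_le a (dedup_sublist eq l).length_le fun b _ => ha b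
    have := ih hl
    simp only [dedup, Timed.time_bind, Timed.time_tick, List.length_cons]
    split <;> rw [Timed.time_pure] <;> nlinarith

/-- The test `eq` decides equality. -/
def IsEqTest (eq : α → α → Timed Bool) : Prop := ∀ a b, (eq a b).val = true ↔ a = b

theorem isEqTest_symEq [DecidableEq α] : IsEqTest (symEq (α := α)) := fun _ _ => by
  simp [symEq]

namespace IsEqTest

variable (heq : IsEqTest eq)

include heq

theorem listEq : IsEqTest (listEq eq) := fun l k => by
  induction l generalizing k with
  | nil => cases k <;> simp [Naive.listEq]
  | cons a l ih =>
    cases k with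
    | nil => simp [Naive.listEq]
    | cons b k =>
      simp only [Naive.listEq, Timed.val_bind, List.cons.injEq, ← heq a b]
      split <;> simp_all

theorem mem_iff (a : α) (l : List α) : (mem eq a l).val = true ↔ a ∈ l := by
  induction l with
  | nil => simp [mem]
  | cons b l ih =>
    simp only [mem, Timed.val_bind, List.mem_cons, ← heq a b]
    split <;> simp_all

theorem mem_dedup (a : α) (l : List α) : a ∈ (dedup eq l).val ↔ a ∈ l := by
  induction l with
  | nil => simp [dedup]
  | cons b l ih =>
    rw [val_dedup_cons, List.mem_cons, ← ih]
    split
    case isTrue h => exact ⟨.inr, fun h' => h'.elim (· ▸ (heq.mem_iff b _).1 h) id⟩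
    case isFalse => exact List.mem_cons

theorem nodup_dedup (l : List α) : (dedup eq l).val.Nodup := by
  induction l with
  | nil => exact List.nodup_nil
  | cons a l ih =>
    rw [val_dedup_cons]
    split
    case isTrue => exact ih
    case isFalse h => exact List.nodup_cons.2 ⟨mt (heq.mem_iff a _).2 h, ih⟩

end IsEqTest

@[simp]
theorem val_tuples_succ (cs : List α) (k : ℕ) :
    (tuples cs (k + 1)).val = cs.flatMap fun c => (tuples cs k).val.map (c :: ·) := by
  simp [tuples]

theorem mem_tuples {cs : List α} {k : ℕ} {as : List α} :
    as ∈ (tuples cs k).val ↔ as.length = k ∧ ∀ c ∈ as, c ∈ cs := by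
  induction k generalizing as with
  | zero => cases as <;> simp [tuples]
  | succ k ih => cases as <;> simp [ih, and_left_comm]

theorem length_tuples (cs : List α) (k : ℕ) : (tuples cs k).val.length = cs.length ^ k := by
  induction k with
  | zero => simp [tuples]
  | succ k ih => simp [List.length_flatMap, ih, pow_succ']

theorem length_tuples_le {cs : List α} {u k w : ℕ} (hu : cs.length ≤ u) (hk : k ≤ w) :
    (tuples cs k).val.length ≤ (u + 1) ^ w :=
  (length_tuples cs k).trans_le <| calc
    cs.length ^ k ≤ (u + 1) ^ k := by gcongr; omega
    _ ≤ (u + 1) ^ w := Nat.pow_le_pow_right u.succ_pos hk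

theorem time_tuples_le {cs : List α} {u k w : ℕ} (hu : cs.length ≤ u) (hk : k ≤ w) :
    (tuples cs k).time ≤ 8 * (w + 1) * (u + 1) ^ w := by
  suffices h : (tuples cs k).time ≤ 8 * (k + 1) * (u + 1) ^ k from h.trans <| by gcongr; omega
  clear hk
  induction k with
  | zero => simp [tuples]
  | succ k ih =>
    have hlen := length_tuples_le hu (le_refl k)
    calc (tuples cs (k + 1)).time
        ≤ 1 + (8 * (k + 1) * (u + 1) ^ k +
            (u + 1) * (((u + 1) ^ k + 1) * (1 + 1) + (u + 1) ^ k + 2)) :=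
          Nat.add_le_add_left (Nat.add_le_add ih (time_flatMap_le hu
            (fun c _ => time_map_le hlen fun _ _ => le_rfl) fun c _ => by simpa using hlen)) 1
      _ ≤ 8 * (k + 1 + 1) * (u + 1) ^ (k + 1) := by
          -- With `(u + 1) ^ k = V + 1` the inequality holds coefficientwise, as `omega` sees.
          obtain ⟨V, hV⟩ := Nat.exists_eq_add_of_le' (Nat.one_le_pow k (u + 1) u.succ_pos)
          rw [pow_succ, hV]
          ring_nf
          omega

end ListAlgorithms

end Naive

end PDatalog

/-! ### Ground instances -/

namespace PDatalog

variable {Pred τ Const : Type}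

namespace PRule

/-- At most `w` body atoms, and at most `w` arguments in each atom. -/
structure SizeLE (w : ℕ) (r : PRule Pred τ) : Prop where
  length_body : r.body.length ≤ w
  length_args : ∀ A ∈ r.head :: r.body, A.args.length ≤ w

theorem SizeLE.length_atoms {w : ℕ} {r : PRule Pred τ} (hr : r.SizeLE w) :
    (r.head :: r.body).length ≤ w + 1 := Nat.succ_le_succ hr.length_body

theorem SizeLE.subst {w : ℕ} {r : PRule Pred (Term Const)} (hr : r.SizeLE w) (θ : ℕ → Const) :
    (r.subst θ).SizeLE w where
  length_body := by simpa using hr.length_body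
  length_args := by simpa [Atom.subst] using hr.length_args

/-- The variables occurring in a p-rule, with repetitions. -/
def vars (r : PRule Pred (Term Const)) : List ℕ := (r.head :: r.body).flatMap Atom.vars

theorem subst_eq_of_vars {θ θ' : ℕ → Const} {r : PRule Pred (Term Const)}
    (h : ∀ i ∈ r.vars, θ i = θ' i) : r.subst θ = r.subst θ' :=
  r.subst_congr fun A hA i hi => h i (List.mem_flatMap.2 ⟨A, hA, hi⟩)

end PRule

namespace Naive

variable {w u : ℕ}

section Equality

variable [DecidableEq Pred] [DecidableEq τ]

theorem isEqTest_atomEq : IsEqTest (atomEq (Pred := Pred) (Const := τ)) := fun A B => by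
  rw [Atom.ext_iff, ← isEqTest_symEq A.pred, ← isEqTest_symEq.listEq A.args]
  simp only [atomEq, Timed.val_bind]
  split <;> simp_all

theorem isEqTest_ruleEq : IsEqTest (ruleEq (Pred := Pred) (Const := τ)) := by
  rintro (⟨A, c⟩ | ⟨A, c, μ, as⟩) (⟨B, d⟩ | ⟨B, d, ν, bs⟩)
  · rw [PRule.fact.injEq, ← isEqTest_atomEq A]
    simp only [ruleEq, Timed.val_bind]
    split <;> simp_all [confEq]
  · simp [ruleEq]
  · simp [ruleEq]
  · rw [PRule.rule.injEq, ← isEqTest_atomEq A, ← isEqTest_atomEq.listEq as]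
    simp [ruleEq, confEq, modeEq, and_assoc]

theorem time_atomEq_le {A : Atom Pred τ} (B : Atom Pred τ) (hA : A.args.length ≤ w) :
    (atomEq A B).time ≤ 3 * (w + 1) := by
  have hargs : (listEq symEq A.args B.args).time ≤ (w + 1) * (1 + 1) :=
    time_listEq_le _ hA fun _ _ _ => le_rfl
  have hpred : (symEq A.pred B.pred).time = 1 := rfl
  rw [atomEq, Timed.time_bind]
  split
  · omega
  · rw [Timed.time_pure]
    omega

theorem time_ruleEq_le {r : PRule Pred τ} (s : PRule Pred τ) (hr : r.SizeLE w) :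
    (ruleEq r s).time ≤ 13 * (w + 1) ^ 2 := by
  have hhead B : (atomEq r.head B).time ≤ 3 * (w + 1) :=
    time_atomEq_le B (hr.length_args _ List.mem_cons_self)
  have hbody bs : (listEq atomEq r.body bs).time ≤ (w + 1) * (3 * (w + 1) + 1) :=
    time_listEq_le bs hr.length_body fun A hA B =>
      time_atomEq_le B (hr.length_args A (List.mem_cons_of_mem _ hA))
  have hconf (c d : Conf) : (confEq c d).time = 4 := rfl
  have hmode (μ ν : Mode) : (modeEq μ ν).time = 1 := rfl
  cases r <;> cases s <;>
    simp only [ruleEq, Timed.time_bind, Timed.time_tick, Timed.time_pure, hconf, hmode]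
  case fact.fact A c B d =>
    have := hhead B
    simp only [PRule.head] at this
    split
    · rw [hconf]
      nlinarith
    · rw [Timed.time_pure]
      nlinarith
  case rule.rule A c μ as B d ν bs =>
    have := hhead B
    have := hbody bs
    simp only [PRule.head, PRule.body] at *
    nlinarith
  all_goals
    ring_nf
    omega

end Equality

section Grounding

theorem time_flatMap_args_le {β : Type} {f : τ → Timed (List β)} {r : PRule Pred τ}
    (hr : r.SizeLE w) (ht : ∀ x, (f x).time ≤ 1) (hs : ∀ x, (f x).val.length ≤ 1) :
    (flatMap (fun A => flatMap f A.args) (r.head :: r.body)).time + 1 ≤ 13 * (w + 1) ^ 2 := by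
  have hlen : ∀ A ∈ r.head :: r.body, (flatMap f A.args).val.length ≤ w * 1 := fun A hA => by
    rw [val_flatMap]
    exact length_flatMap_le (hr.length_args A hA) fun x _ => hs x
  have := time_flatMap_le hr.length_atoms
    (fun A hA => time_flatMap_le (hr.length_args A hA) (fun x _ => ht x) fun x _ => hs x) hlen
  nlinarith

theorem length_flatMap_args_le {β : Type} {f : τ → List β} {r : PRule Pred τ}
    (hr : r.SizeLE w) (hs : ∀ x, (f x).length ≤ 1) :
    ((r.head :: r.body).flatMap fun A => A.args.flatMap f).length ≤ (w + 1) ^ 2 :=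
  calc _ ≤ (w + 1) * (w * 1) := length_flatMap_le hr.length_atoms fun A hA =>
        length_flatMap_le (hr.length_args A hA) fun x _ => hs x
    _ ≤ (w + 1) ^ 2 := by nlinarith

variable {r : PRule Pred (Term Const)}

@[simp]
theorem val_ruleConsts (r : PRule Pred (Term Const)) : (ruleConsts r).val = r.consts :=
  (val_flatMap _ _).trans (List.flatMap_congr fun _ _ => val_flatMap _ _)

theorem time_ruleConsts_le (hr : r.SizeLE w) : (ruleConsts r).time ≤ 13 * (w + 1) ^ 2 :=
  (Nat.add_comm _ _).trans_le <|
    time_flatMap_args_le hr (fun _ => le_rfl) fun t => by cases t <;> simp [Term.consts]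

theorem length_consts_le (hr : r.SizeLE w) : r.consts.length ≤ (w + 1) ^ 2 :=
  length_flatMap_args_le hr fun t => by cases t <;> simp [Term.consts]

@[simp]
theorem val_ruleVars (r : PRule Pred (Term Const)) : (ruleVars r).val = r.vars :=
  (val_flatMap _ _).trans (List.flatMap_congr fun _ _ => val_flatMap _ _)

theorem time_ruleVars_le (hr : r.SizeLE w) : (ruleVars r).time ≤ 13 * (w + 1) ^ 2 :=
  (Nat.add_comm _ _).trans_le <|
    time_flatMap_args_le hr (fun _ => le_rfl) fun t => by cases t <;> simp [termVars, Term.vars]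

theorem length_vars_le (hr : r.SizeLE w) : r.vars.length ≤ (w + 1) ^ 2 :=
  length_flatMap_args_le hr fun t => by cases t <;> simp [Term.vars]

theorem val_bound_le_iff (l : List ℕ) : (bound l).val ≤ w ↔ ∀ i ∈ l, i < w := by
  induction l with
  | nil => simp [bound]
  | cons i l ih => simp [bound, ih]

theorem time_bound (l : List ℕ) : (bound l).time = l.length + 1 := by
  induction l with
  | nil => rfl
  | cons i l ih => simp [bound, ih, Nat.add_comm]

variable [Inhabited Const] {as : List Const}

theorem val_termSubst (as : List Const) (t : Term Const) :
    (termSubst as t).val = t.subst fun i => as.getD i default := by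
  cases t
  · exact val_get _ _ _
  · rfl

theorem time_termSubst_le (has : as.length ≤ w) (t : Term Const) :
    (termSubst as t).time ≤ 2 * (w + 1) := by
  cases t with
  | var i =>
    have := time_get_le default i has
    simp only [termSubst, Timed.time_bind, Timed.time_tick]
    omega
  | const c =>
    simp only [termSubst, Timed.time_bind, Timed.time_tick, Timed.time_pure]
    omega

theorem val_atomSubst (as : List Const) (A : Atom Pred (Term Const)) :
    (atomSubst as A).val = A.subst fun i => as.getD i default := by
  simp [atomSubst, Atom.subst, val_termSubst]

theorem time_atomSubst_le (has : as.length ≤ w) {A : Atom Pred (Term Const)}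
    (hA : A.args.length ≤ w) : (atomSubst as A).time ≤ 4 * (w + 1) ^ 2 := by
  have := time_map_le hA fun t _ => time_termSubst_le has t
  simp only [atomSubst, Timed.time_bind, Timed.time_tick, Timed.time_pure]
  nlinarith

theorem val_ruleSubst (as : List Const) (r : PRule Pred (Term Const)) :
    (ruleSubst as r).val = r.subst fun i => as.getD i default := by
  cases r <;> simp [ruleSubst, PRule.subst, val_atomSubst]

theorem time_ruleSubst_le (has : as.length ≤ w) (hr : r.SizeLE w) :
    (ruleSubst as r).time ≤ 10 * (w + 1) ^ 3 := by
  have hhead := time_atomSubst_le has (hr.length_args _ List.mem_cons_self)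
  have hbody : (map (atomSubst as) r.body).time ≤ (w + 1) * (4 * (w + 1) ^ 2 + 1) :=
    time_map_le hr.length_body fun A hA =>
      time_atomSubst_le has (hr.length_args A (List.mem_cons_of_mem _ hA))
  cases r <;> simp only [ruleSubst, PRule.head, PRule.body, Timed.time_bind, Timed.time_tick,
    Timed.time_pure] at * <;> ring_nf at * <;> omega

variable {cs : List Const}

theorem mem_instances (hcs : cs ≠ []) {g : PRule Pred Const} :
    g ∈ (instances cs r).val ↔ ∃ θ : ℕ → Const, (∀ i, θ i ∈ cs) ∧ g = r.subst θ := by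
  have hlt := (val_bound_le_iff r.vars).1 le_rfl
  simp only [instances, Timed.val_bind, val_map, List.mem_map, mem_tuples, val_ruleVars,
    val_ruleSubst]
  generalize (bound r.vars).val = k at hlt
  constructor
  · rintro ⟨as, ⟨rfl, has⟩, rfl⟩
    obtain ⟨c, hc⟩ := List.exists_mem_of_ne_nil cs hcs
    refine ⟨fun i => as.getD i c, fun i => ?_, PRule.subst_eq_of_vars fun i hi => ?_⟩
    · by_cases hi : i < as.length
      · exact has _ (by simp [hi])
      · simpa [hi] using hc
    · simp [hlt i hi]
  · rintro ⟨θ, hθ, rfl⟩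
    refine ⟨(List.range k).map θ, ⟨by simp, by simp [hθ]⟩, ?_⟩
    refine PRule.subst_eq_of_vars fun i hi => ?_
    simp [hlt i hi]

theorem sizeLE_of_mem_instances (hr : r.SizeLE w) {g : PRule Pred Const}
    (hg : g ∈ (instances cs r).val) : g.SizeLE w := by
  simp only [instances, Timed.val_bind, val_map, List.mem_map, val_ruleSubst] at hg
  obtain ⟨as, -, rfl⟩ := hg
  exact hr.subst _

theorem length_instances_le (hcs : cs.length ≤ u) (hvars : ∀ i ∈ r.vars, i < w) :
    (instances cs r).val.length ≤ (u + 1) ^ w := by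
  simpa [instances] using length_tuples_le hcs ((val_bound_le_iff _).2 hvars)

theorem time_instances_le (hcs : cs.length ≤ u) (hr : r.SizeLE w) (hvars : ∀ i ∈ r.vars, i < w) :
    (instances cs r).time ≤ 45 * (w + 1) ^ 3 * (u + 1) ^ w := by
  have hk := (val_bound_le_iff _).2 hvars
  have hmap := time_map_le (length_tuples_le hcs hk) fun as has =>
    time_ruleSubst_le ((mem_tuples.1 has).1.trans_le hk) hr
  have hbound : (bound r.vars).time ≤ (w + 1) ^ 2 + 1 :=
    (time_bound _).trans_le (Nat.succ_le_succ (length_vars_le hr))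
  calc (instances cs r).time
      ≤ 13 * (w + 1) ^ 2 + ((w + 1) ^ 2 + 1 + (8 * (w + 1) * (u + 1) ^ w +
          ((u + 1) ^ w + 1) * (10 * (w + 1) ^ 3 + 1))) := by
        simp only [instances, Timed.time_bind, val_ruleVars]
        exact Nat.add_le_add (time_ruleVars_le hr)
          (Nat.add_le_add hbound (Nat.add_le_add (time_tuples_le hcs hk) hmap))
    _ ≤ 45 * (w + 1) ^ 3 * (u + 1) ^ w := by
        obtain ⟨V, hV⟩ := Nat.exists_eq_add_of_le' (Nat.one_le_pow w (u + 1) u.succ_pos)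
        rw [hV]
        ring_nf
        omega

end Grounding

end Naive

end PDatalog

namespace PDatalog

variable {Pred Const : Type} {arity : Pred → ℕ}

theorem PProgram.herbrand_nonempty [DecidableEq Const] [Inhabited Const]
    (P : PProgram Pred Const arity) : P.herbrand.Nonempty := by
  unfold herbrand
  split_ifs with h
  · exact Finset.singleton_nonempty _
  · exact Finset.nonempty_iff_ne_empty.2 h

namespace Naive

variable {w u L p : ℕ} {rules : List (PRule Pred (Term Const))} {univ : List Const}
  {preds : List Pred}

section HerbrandBase

/-- The third phase of `setup`: the table of the valuation **false** over a list of constants. -/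
def falseTable (arity : Pred → ℕ) (preds : List Pred) (univ : List Const) :
    Timed (Table Pred Const) :=
  flatMap (fun p => do
    Timed.tick 1
    let ts ← tuples univ (arity p)
    map (fun t => do Timed.tick 1; return ((⟨p, t⟩ : Atom Pred Const), Conf.falsum)) ts) preds

/-- The Herbrand base over a list of constants, in the order of the tables. -/
def groundAtoms (arity : Pred → ℕ) (preds : List Pred) (univ : List Const) :
    List (Atom Pred Const) :=
  preds.flatMap fun p => (tuples univ (arity p)).val.map (Atom.mk p)

/-- The table of the function `f` with one entry for each atom of `as`. -/
def tableOf (as : List (Atom Pred Const)) (f : Atom Pred Const → Conf) : Table Pred Const :=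
  as.map fun A => (A, f A)

theorem length_groundAtoms_le (hp : preds.length ≤ p) (hu : univ.length ≤ u)
    (har : ∀ p, arity p ≤ w) : (groundAtoms arity preds univ).length ≤ p * (u + 1) ^ w :=
  length_flatMap_le hp fun p _ => by simpa using length_tuples_le hu (har p)

theorem val_falseTable (arity : Pred → ℕ) (preds : List Pred) (univ : List Const) :
    (falseTable arity preds univ).val =
      tableOf (groundAtoms arity preds univ) fun _ => Conf.falsum := by
  simp [falseTable, groundAtoms, tableOf, List.map_flatMap, Function.comp_def]

theorem time_falseTable_le (hp : preds.length ≤ p) (hu : univ.length ≤ u)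
    (har : ∀ p, arity p ≤ w) :
    (falseTable arity preds univ).time ≤ 16 * (p + 1) * (w + 1) * (u + 1) ^ w := by
  refine (time_flatMap_le (t := 1 + (8 * (w + 1) * (u + 1) ^ w + ((u + 1) ^ w + 1) * (1 + 1)))
    (s := (u + 1) ^ w) hp (fun p _ => ?_) fun p _ => ?_).trans ?_
  · have hmap : (map (fun t => do Timed.tick 1; return ((⟨p, t⟩ : Atom Pred Const), Conf.falsum))
        (tuples univ (arity p)).val).time ≤ ((u + 1) ^ w + 1) * (1 + 1) :=
      time_map_le (length_tuples_le hu (har p)) fun _ _ => le_rfl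
    exact Nat.add_le_add_left (Nat.add_le_add (time_tuples_le hu (har p)) hmap) 1
  · simpa using length_tuples_le hu (har p)
  · obtain ⟨V, hV⟩ := Nat.exists_eq_add_of_le' (Nat.one_le_pow w (u + 1) u.succ_pos)
    rw [hV]
    ring_nf
    omega

end HerbrandBase

section HerbrandUniverse

variable [DecidableEq Const]

/-- The first phase of `setup`: the constants of the listed p-rules, without repetition. -/
def collectConsts (rules : List (PRule Pred (Term Const))) : Timed (List Const) := do
  let cs ← flatMap ruleConsts rules
  dedup symEq cs

theorem mem_collectConsts {P : PProgram Pred Const arity}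
    (hrules : ∀ r, r ∈ rules ↔ r ∈ P.rules) {c : Const} :
    c ∈ (collectConsts rules).val ↔ c ∈ P.consts := by
  simp [collectConsts, isEqTest_symEq.mem_dedup, PProgram.consts, hrules]

theorem length_collectConsts {P : PProgram Pred Const arity}
    (hrules : ∀ r, r ∈ rules ↔ r ∈ P.rules) : (collectConsts rules).val.length = P.dbSize := by
  have hnodup : (collectConsts rules).val.Nodup := isEqTest_symEq.nodup_dedup _
  rw [← List.toFinset_card_of_nodup hnodup, PProgram.dbSize]
  congr 1
  ext c
  rw [List.mem_toFinset, mem_collectConsts hrules]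

theorem time_collectConsts_le (hL : rules.length ≤ L) (hsize : ∀ r ∈ rules, r.SizeLE w) :
    (collectConsts rules).time ≤ 18 * (L + 1) ^ 2 * (w + 1) ^ 4 := by
  have hcollect := time_flatMap_le hL (fun r hr => time_ruleConsts_le (hsize r hr)) fun r hr =>
    (val_ruleConsts r).symm ▸ length_consts_le (hsize r hr)
  have hlen : (flatMap ruleConsts rules).val.length ≤ L * (w + 1) ^ 2 := by
    simpa using length_flatMap_le hL fun r hr => length_consts_le (hsize r hr)
  calc (collectConsts rules).time
      ≤ (L + 1) * (13 * (w + 1) ^ 2 + (w + 1) ^ 2 + 2) + (L * (w + 1) ^ 2 + 1) ^ 2 * (1 + 1) :=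
        Nat.add_le_add hcollect (time_dedup_le hlen fun _ _ _ => le_rfl)
    _ ≤ 18 * (L + 1) ^ 2 * (w + 1) ^ 4 := by
        ring_nf
        omega

variable [Inhabited Const] {P : PProgram Pred Const arity}

/-- The Herbrand universe as listed by `setup`. -/
def herbrandList (rules : List (PRule Pred (Term Const))) : List Const :=
  match (collectConsts rules).val with
  | [] => [default]
  | c :: l => c :: l

theorem mem_herbrandList (hrules : ∀ r, r ∈ rules ↔ r ∈ P.rules) {c : Const} :
    c ∈ herbrandList rules ↔ c ∈ P.herbrand := by
  have hmem d : d ∈ (collectConsts rules).val ↔ d ∈ P.consts := mem_collectConsts hrules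
  unfold herbrandList PProgram.herbrand
  split
  case h_1 h =>
    rw [if_pos (Finset.eq_empty_of_forall_notMem fun d hd => by simpa [h] using (hmem d).2 hd)]
    simp
  case h_2 d l h =>
    rw [if_neg (Finset.ne_empty_of_mem ((hmem d).1 (by simp [h]))), ← hmem, h]

theorem length_herbrandList_le (hrules : ∀ r, r ∈ rules ↔ r ∈ P.rules) :
    (herbrandList rules).length ≤ P.dbSize + 1 := by
  rw [← length_collectConsts hrules, herbrandList]
  split
  case h_1 => simp
  case h_2 h => simp [h]

theorem mem_groundAtoms (hpreds : ∀ p, p ∈ preds) (huniv : ∀ c, c ∈ univ ↔ c ∈ P.herbrand)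
    {A : Atom Pred Const} : A ∈ groundAtoms arity preds univ ↔ A ∈ P.base := by
  obtain ⟨p, as⟩ := A
  simp [groundAtoms, mem_tuples, hpreds, huniv, PProgram.base]

end HerbrandUniverse

section HerbrandInstantiation

variable [Inhabited Const]

theorem length_instances_flatMap_le (hL : rules.length ≤ L) (hu : univ.length ≤ u)
    (hvars : ∀ r ∈ rules, ∀ i ∈ r.vars, i < w) :
    (flatMap (instances univ) rules).val.length ≤ L * (u + 1) ^ w := by
  rw [val_flatMap]
  exact length_flatMap_le hL fun r hr => length_instances_le hu (hvars r hr)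

theorem sizeLE_of_mem_flatMap_instances (hsize : ∀ r ∈ rules, r.SizeLE w) {g : PRule Pred Const}
    (hg : g ∈ (flatMap (instances univ) rules).val) : g.SizeLE w := by
  rw [val_flatMap] at hg
  obtain ⟨r, hr, hg⟩ := List.mem_flatMap.1 hg
  exact sizeLE_of_mem_instances (hsize r hr) hg

variable [DecidableEq Pred] [DecidableEq Const]

/-- The second phase of `setup`: the Herbrand instantiation over a list of constants. -/
noncomputable def groundRules (univ : List Const) (rules : List (PRule Pred (Term Const))) :
    Timed (List (PRule Pred Const)) := do
  let gs ← flatMap (instances univ) rules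
  dedup ruleEq gs

theorem mem_groundRules {P : PProgram Pred Const arity} (hrules : ∀ r, r ∈ rules ↔ r ∈ P.rules)
    (huniv : ∀ c, c ∈ univ ↔ c ∈ P.herbrand) {g : PRule Pred Const} :
    g ∈ (groundRules univ rules).val ↔ g ∈ P.ground := by
  obtain ⟨c, hc⟩ := P.herbrand_nonempty
  have hne : univ ≠ [] := List.ne_nil_of_mem ((huniv c).2 hc)
  simp [groundRules, isEqTest_ruleEq.mem_dedup, mem_instances hne, hrules, huniv, PProgram.ground]

theorem nodup_groundRules (univ : List Const) (rules : List (PRule Pred (Term Const))) :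
    (groundRules univ rules).val.Nodup :=
  isEqTest_ruleEq.nodup_dedup _

theorem length_groundRules_le (hL : rules.length ≤ L) (hu : univ.length ≤ u)
    (hvars : ∀ r ∈ rules, ∀ i ∈ r.vars, i < w) :
    (groundRules univ rules).val.length ≤ L * (u + 1) ^ w :=
  (dedup_sublist _ _).length_le.trans (length_instances_flatMap_le hL hu hvars)

theorem sizeLE_of_mem_groundRules (hsize : ∀ r ∈ rules, r.SizeLE w) {g : PRule Pred Const}
    (hg : g ∈ (groundRules univ rules).val) : g.SizeLE w :=
  sizeLE_of_mem_flatMap_instances hsize ((dedup_sublist _ _).subset hg)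

theorem time_groundRules_le (hL : rules.length ≤ L) (hu : univ.length ≤ u)
    (hsize : ∀ r ∈ rules, r.SizeLE w) (hvars : ∀ r ∈ rules, ∀ i ∈ r.vars, i < w) :
    (groundRules univ rules).time ≤ 62 * (L + 1) ^ 2 * (w + 1) ^ 3 * ((u + 1) ^ w) ^ 2 := by
  have hinst := time_flatMap_le hL (fun r hr => time_instances_le hu (hsize r hr) (hvars r hr))
    fun r hr => length_instances_le hu (hvars r hr)
  have hdedup := time_dedup_le (eq := ruleEq) (length_instances_flatMap_le hL hu hvars)
    fun _ hg h => time_ruleEq_le h (sizeLE_of_mem_flatMap_instances hsize hg)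
  refine (Nat.add_le_add hinst hdedup).trans ?_
  obtain ⟨V, hV⟩ := Nat.exists_eq_add_of_le' (Nat.one_le_pow w (u + 1) u.succ_pos)
  rw [hV]
  ring_nf
  omega

theorem val_setup (arity : Pred → ℕ) (preds : List Pred)
    (rules : List (PRule Pred (Term Const))) :
    (setup arity preds rules).val = ((groundRules (herbrandList rules) rules).val,
      tableOf (groundAtoms arity preds (herbrandList rules)) fun _ => Conf.falsum) :=
  congrArg (Prod.mk _) (val_falseTable arity preds _)

theorem time_setup (arity : Pred → ℕ) (preds : List Pred)
    (rules : List (PRule Pred (Term Const))) :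
    (setup arity preds rules).time = (collectConsts rules).time + 1 +
      (groundRules (herbrandList rules) rules).time +
      (falseTable arity preds (herbrandList rules)).time := by
  have h : (setup arity preds rules).time = (flatMap ruleConsts rules).time +
      ((dedup symEq (flatMap ruleConsts rules).val).time + (1 +
        ((flatMap (instances (herbrandList rules)) rules).time +
          ((dedup ruleEq (flatMap (instances (herbrandList rules)) rules).val).time +
            ((falseTable arity preds (herbrandList rules)).time + 0))))) := rfl
  rw [h, collectConsts, groundRules, Timed.time_bind, Timed.time_bind]
  omega

theorem time_setup_le (hp : preds.length ≤ p) (hL : rules.length ≤ L)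
    (hu : (herbrandList rules).length ≤ u) (hsize : ∀ r ∈ rules, r.SizeLE w)
    (hvars : ∀ r ∈ rules, ∀ i ∈ r.vars, i < w) (har : ∀ p, arity p ≤ w) :
    (setup arity preds rules).time ≤
      100 * (p + L + 1) ^ 2 * (w + 1) ^ 4 * ((u + 1) ^ w) ^ 2 := by
  have hconsts := time_collectConsts_le hL hsize
  have hground := time_groundRules_le hL hu hsize hvars
  have htable := time_falseTable_le hp hu har
  rw [time_setup]
  refine (Nat.add_le_add (Nat.add_le_add (Nat.add_le_add_right hconsts 1) hground) htable).trans ?_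
  obtain ⟨V, hV⟩ := Nat.exists_eq_add_of_le' (Nat.one_le_pow w (u + 1) u.succ_pos)
  rw [hV]
  ring_nf
  omega

end HerbrandInstantiation

end Naive

end PDatalog

/-! ### Iterations -/

namespace PDatalog

variable {Pred Const : Type} [DecidableEq Pred] [DecidableEq Const]

namespace Naive

section IterationTime

variable {w n G : ℕ} {tab : Table Pred Const} {gs : List (PRule Pred Const)}

theorem time_lookup_le {A : Atom Pred Const} (hA : A.args.length ≤ w) (htab : tab.length ≤ n) :
    (lookup A tab).time ≤ 4 * (n + 1) * (w + 1) := by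
  suffices h : (lookup A tab).time ≤ 4 * (tab.length + 1) * (w + 1) from h.trans <| by gcongr
  clear htab
  induction tab with
  | nil => exact Nat.succ_le_of_lt (n := 0) (by positivity)
  | cons e tab ih =>
    have heq := time_atomEq_le e.1 hA
    simp only [lookup, Timed.time_bind, Timed.time_tick, List.length_cons]
    split
    · rw [Timed.time_pure]
      nlinarith
    · nlinarith

theorem time_bodyConf_le (μ : Mode) (c : Conf) {bs : List (Atom Pred Const)}
    (hbs : bs.length ≤ w) (hargs : ∀ B ∈ bs, B.args.length ≤ w) (htab : tab.length ≤ n) :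
    (bodyConf tab μ c bs).time ≤ 21 * (n + 1) * (w + 1) ^ 2 := by
  suffices h : (bodyConf tab μ c bs).time ≤ (bs.length + 1) * (21 * (n + 1) * (w + 1)) from
    h.trans <| by nlinarith [Nat.mul_le_mul_right (21 * (n + 1) * (w + 1)) hbs]
  clear hbs
  induction bs generalizing c with
  | nil => exact Nat.succ_le_of_lt (n := 0) (by positivity)
  | cons B bs ih =>
    rw [List.forall_mem_cons] at hargs
    have hlookup := time_lookup_le hargs.1 htab
    have htail := ih (Conf.conj μ c (lookup B tab).val) hargs.2
    have hcons : (bodyConf tab μ c (B :: bs)).time = 1 + ((lookup B tab).time +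
        (16 + (bodyConf tab μ (Conf.conj μ c (lookup B tab).val) bs).time)) := rfl
    rw [hcons, List.length_cons]
    nlinarith

theorem time_ruleConf_le {g : PRule Pred Const} (hg : g.SizeLE w) (htab : tab.length ≤ n) :
    (ruleConf tab g).time ≤ 22 * (n + 1) * (w + 1) ^ 2 := by
  have hpos : 0 < (n + 1) * (w + 1) ^ 2 := by positivity
  cases g with
  | fact A c => exact Nat.succ_le_of_lt (n := 0) (by positivity)
  | rule A c μ bs =>
    have hbody := time_bodyConf_le μ c hg.length_body
      (fun B hB => hg.length_args B (List.mem_cons_of_mem _ hB)) htab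
    exact (Nat.add_le_add_left hbody 1).trans (by linarith)

theorem time_atomConf_le (μ : Mode) (A : Atom Pred Const) (hgs : gs.length ≤ G)
    (hsize : ∀ g ∈ gs, g.SizeLE w) (htab : tab.length ≤ n) :
    (atomConf μ tab A gs).time ≤ 42 * (G + 1) * (n + 1) * (w + 1) ^ 2 := by
  suffices h : (atomConf μ tab A gs).time ≤ (gs.length + 1) * (42 * (n + 1) * (w + 1) ^ 2) from
    h.trans <| by nlinarith [Nat.mul_le_mul_right (42 * (n + 1) * (w + 1) ^ 2) hgs]
  clear hgs
  induction gs with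
  | nil => exact Nat.succ_le_of_lt (n := 0) (by positivity)
  | cons g gs ih =>
    rw [List.forall_mem_cons] at hsize
    have htail := ih hsize.2
    have hhead := time_atomEq_le A (hsize.1.length_args _ List.mem_cons_self)
    have hconf := time_ruleConf_le hsize.1 htab
    simp only [atomConf, Timed.time_bind, Timed.time_tick, List.length_cons]
    split
    · simp only [disj, Timed.time_bind, Timed.time_tick, Timed.time_pure]
      nlinarith
    · rw [Timed.time_pure]
      nlinarith

theorem time_iteration_le (modes : Pred → Mode) (hgs : gs.length ≤ G)
    (hsize : ∀ g ∈ gs, g.SizeLE w) (htab : tab.length ≤ n) :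
    (iteration modes gs tab).time ≤ 50 * (G + 1) * (n + 1) ^ 2 * (w + 1) ^ 2 := by
  have hmap := time_map_le (t := 42 * (G + 1) * (n + 1) * (w + 1) ^ 2 + 1) (f := fun e => do
      Timed.tick 1
      let c ← atomConf (modes e.1.pred) tab e.1 gs
      return (e.1, c)) htab fun e _ => by
    simpa [Nat.add_comm] using time_atomConf_le (modes e.1.pred) e.1 hgs hsize htab
  have hsame tab' : (listEq (fun e e' => confEq e.2 e'.2) tab tab').time ≤ (n + 1) * (4 + 1) :=
    time_listEq_le tab' htab fun _ _ _ => le_rfl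
  refine (Nat.add_le_add hmap (Nat.add_le_add (hsame _) (le_refl 0))).trans ?_
  ring_nf
  omega

end IterationTime

section IterationValue

variable {as : List (Atom Pred Const)} {f : Atom Pred Const → Conf}

theorem val_lookup {A : Atom Pred Const} (hA : A ∉ as → f A = Conf.falsum) :
    (lookup A (tableOf as f)).val = f A := by
  induction as with
  | nil => exact (hA List.not_mem_nil).symm
  | cons B as ih =>
    simp only [tableOf, List.map_cons, lookup, Timed.val_bind]
    split
    case isTrue h => rw [(isEqTest_atomEq A B).1 h, Timed.val_pure]
    case isFalse h =>
      exact ih fun has => hA (List.not_mem_cons_of_ne_of_not_mem (mt (isEqTest_atomEq A B).2 h) has)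

theorem val_ruleConf (hf : ∀ A ∉ as, f A = Conf.falsum) (g : PRule Pred Const) :
    (ruleConf (tableOf as f) g).val = g.ruleConf f := by
  cases g with
  | fact A c => rfl
  | rule A c μ bs =>
    simp only [ruleConf, Timed.val_bind, PRule.ruleConf]
    induction bs generalizing c with
    | nil => rfl
    | cons B bs ih =>
      simp only [bodyConf, Timed.val_bind, val_lookup (hf B), List.foldl_cons]
      exact ih _

theorem val_atomConf (hf : ∀ A ∉ as, f A = Conf.falsum) (μ : Mode) (A : Atom Pred Const)
    (gs : List (PRule Pred Const)) :
    (atomConf μ (tableOf as f) A gs).val =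
      ((gs.filter fun g => (atomEq g.head A).val).map (PRule.ruleConf f)).foldr (Conf.disj μ)
        Conf.falsum := by
  induction gs with
  | nil => rfl
  | cons g gs ih =>
    simp only [atomConf, Timed.val_bind, List.filter_cons]
    split
    case isTrue => simp [disj, val_ruleConf hf, ih]
    case isFalse => exact ih

theorem val_listEq_map {α β : Type} {eq : β → β → Timed Bool} {as : List α} {f g : α → β} :
    (listEq eq (as.map f) (as.map g)).val = true ↔ ∀ a ∈ as, (eq (f a) (g a)).val = true := by
  induction as with
  | nil => simp [listEq]
  | cons a as ih =>
    rw [List.forall_mem_cons, ← ih]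
    simp only [List.map_cons, listEq, Timed.val_bind]
    split <;> simp_all

theorem val_iteration (modes : Pred → Mode) (gs : List (PRule Pred Const)) :
    (iteration modes gs (tableOf as f)).val.1 = tableOf as fun A =>
      (atomConf (modes A.pred) (tableOf as f) A gs).val := by
  simp [iteration, tableOf]

end IterationValue

section Evaluation

variable [Inhabited Const] {arity : Pred → ℕ} {P : PProgram Pred Const arity}
  {as : List (Atom Pred Const)} {gs : List (PRule Pred Const)}

/-- The listing of the Herbrand base and the Herbrand instantiation that `setup` produces. -/
structure IsGrounding (P : PProgram Pred Const arity) (as : List (Atom Pred Const))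
    (gs : List (PRule Pred Const)) : Prop where
  mem_base : ∀ A, A ∈ as ↔ A ∈ P.base
  mem_ground : ∀ g, g ∈ gs ↔ g ∈ P.ground
  nodup : gs.Nodup

namespace IsGrounding

omit [DecidableEq Pred] in
theorem mem_tableOf (h : IsGrounding P as gs) (v : P.Valuation) {A : Atom Pred Const} {c : Conf} :
    (A, c) ∈ tableOf as (P.value v) ↔ ∃ hA : A ∈ P.base, v ⟨A, hA⟩ = c := by
  simp only [tableOf, List.mem_map, Prod.mk.injEq, h.mem_base]
  constructor
  · rintro ⟨B, hB, rfl, rfl⟩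
    exact ⟨hB, (P.value_of_mem v hB).symm⟩
  · rintro ⟨hA, rfl⟩
    exact ⟨A, hA, rfl, P.value_of_mem v hA⟩

theorem val_atomConf (h : IsGrounding P as gs) (v : P.Valuation) (A : P.base) :
    (atomConf (P.disj A.1.pred) (tableOf as (P.value v)) A.1 gs).val = P.immCons v A := by
  classical
  have hset : P.ground_finite.toFinset.filter (fun g => g.head = A.1) =
      ⟨↑(gs.filter fun g => (atomEq g.head A.1).val), Multiset.coe_nodup.2 (h.nodup.filter _)⟩ := by
    ext g
    simp [h.mem_ground, isEqTest_atomEq g.head A.1]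
  have hfalse B (hB : B ∉ as) : P.value v B = Conf.falsum :=
    P.value_of_notMem v (mt (h.mem_base B).2 hB)
  rw [Naive.val_atomConf hfalse, PProgram.immCons, hset]
  rfl

theorem val_iteration_fst (h : IsGrounding P as gs) (v : P.Valuation) :
    (iteration P.disj gs (tableOf as (P.value v))).val.1 = tableOf as (P.value (P.immCons v)) := by
  rw [val_iteration]
  refine List.map_congr_left fun A hA => congrArg (Prod.mk A) ?_
  have hA := (h.mem_base A).1 hA
  exact (h.val_atomConf v ⟨A, hA⟩).trans (P.value_of_mem _ hA).symm

theorem val_iteration_snd (h : IsGrounding P as gs) (v : P.Valuation) :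
    (iteration P.disj gs (tableOf as (P.value v))).val.2 = true ↔ P.immCons v = v := by
  have hsnd : (iteration P.disj gs (tableOf as (P.value v))).val.2 =
      (listEq (fun e e' => confEq e.2 e'.2) (tableOf as (P.value v))
        (iteration P.disj gs (tableOf as (P.value v))).val.1).val := rfl
  rw [hsnd, h.val_iteration_fst, tableOf, tableOf, val_listEq_map, funext_iff]
  simp only [confEq, Timed.val_bind, Timed.val_pure, decide_eq_true_eq, h.mem_base, Subtype.forall]
  refine forall₂_congr fun A hA => ?_
  rw [P.value_of_mem _ hA, P.value_of_mem _ hA, eq_comm]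

theorem loop_of_fixed (h : IsGrounding P as gs) {v : P.Valuation} (hv : P.immCons v = v) :
    Loop P.disj gs (tableOf as (P.value v)) [(iteration P.disj gs (tableOf as (P.value v))).time]
      (tableOf as (P.value v)) := by
  simpa only [h.val_iteration_fst, hv] using Loop.halt _ ((h.val_iteration_snd v).2 hv)

theorem loop_cons (h : IsGrounding P as gs) {v : P.Valuation} {costs : List ℕ}
    {out : Table Pred Const} (hv : P.immCons v ≠ v)
    (hloop : Loop P.disj gs (tableOf as (P.value (P.immCons v))) costs out) :
    Loop P.disj gs (tableOf as (P.value v))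
      ((iteration P.disj gs (tableOf as (P.value v))).time :: costs) out :=
  .next _ _ _ (Bool.eq_false_iff.2 <| mt (h.val_iteration_snd v).1 hv)
    (h.val_iteration_fst v ▸ hloop)

theorem exists_loop (h : IsGrounding P as gs) {t N : ℕ} {v : P.Valuation}
    (ht : ∀ u, (iteration P.disj gs (tableOf as (P.value u))).time ≤ t)
    (hN : P.immCons^[N + 1] v = P.immCons^[N] v) :
    ∃ costs, Loop P.disj gs (tableOf as (P.value v)) costs
        (tableOf as (P.value (P.immCons^[N] v))) ∧
      P.immCons^[costs.length] v = P.immCons^[N] v ∧ costs.length ≤ N + 1 ∧ ∀ c ∈ costs, c ≤ t := by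
  induction N generalizing v with
  | zero => exact ⟨_, h.loop_of_fixed hN, hN, le_rfl, by simpa using ht v⟩
  | succ N ih =>
    by_cases hv : P.immCons v = v
    · rw [Function.iterate_fixed hv]
      exact ⟨_, h.loop_of_fixed hv, hv, Nat.le_add_left 1 _, by simpa using ht v⟩
    · obtain ⟨costs, hloop, hcosts, hlen, hle⟩ := ih hN
      exact ⟨_ :: costs, h.loop_cons hv hloop, hcosts, Nat.succ_le_succ hlen,
        List.forall_mem_cons.2 ⟨ht v, hle⟩⟩

end IsGrounding

end Evaluation

end Naive

end PDatalog

/-! ### Polynomial bounds -/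

namespace PDatalog

variable {Pred Const : Type}

namespace PRule

/-- At most `w` body atoms, and variables with indices below `w`. -/
structure WidthLE (w : ℕ) (r : PRule Pred (Term Const)) : Prop where
  length_body : r.body.length ≤ w
  lt_of_mem_vars : ∀ i ∈ r.vars, i < w

theorem WidthLE.mono {w w' : ℕ} {r : PRule Pred (Term Const)} (hr : r.WidthLE w) (h : w ≤ w') :
    r.WidthLE w' :=
  ⟨hr.length_body.trans h, fun i hi => (hr.lt_of_mem_vars i hi).trans_le h⟩

theorem exists_widthLE (R : Finset (PRule Pred (Term Const))) : ∃ w, ∀ r ∈ R, r.WidthLE w := by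
  refine ⟨∑ r ∈ R, (r.body.length + r.vars.sum + 1), fun r hr => ?_⟩
  have hle := Finset.single_le_sum (f := fun r => r.body.length + r.vars.sum + 1)
    (fun _ _ => Nat.zero_le _) hr
  exact ⟨by omega, fun i hi => by have := List.le_sum_of_mem hi; omega⟩

theorem body_eq_nil_of_isFact {τ : Type} {r : PRule Pred τ} (hr : r.IsFact) : r.body = [] := by
  cases r
  · rfl
  · exact hr.elim

end PRule

theorem Term.const_subst {t : Term Const} (ht : t.vars = []) (θ : ℕ → Const) :
    .const (t.subst θ) = t := by
  cases t with
  | var i => cases ht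
  | const c => rfl

/-- A ground atom as an atom without variables. -/
def Atom.ofGround (A : Atom Pred Const) : Atom Pred (Term Const) := ⟨A.pred, A.args.map .const⟩

theorem Atom.ofGround_subst {A : Atom Pred (Term Const)} (hA : A.vars = []) (θ : ℕ → Const) :
    (A.subst θ).ofGround = A := by
  have hmap : (A.args.map (Term.subst θ)).map Term.const = A.args := by
    rw [List.map_map]
    exact (List.map_congr_left fun t ht =>
      Term.const_subst (List.flatMap_eq_nil_iff.1 hA t ht) θ).trans (List.map_id _)
  rw [ofGround, subst, hmap]

namespace PProgram

variable {arity : Pred → ℕ} {P : PProgram Pred Const arity} {r : PRule Pred (Term Const)} {w : ℕ}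

theorem vars_head_eq_nil (hr : r ∈ P.rules) (hfact : r.IsFact) : r.head.vars = [] := by
  refine List.eq_nil_iff_forall_not_mem.2 fun x hx => ?_
  obtain ⟨B, hB, -⟩ := P.range_restricted r hr x hx
  simp [PRule.body_eq_nil_of_isFact hfact] at hB

theorem widthLE_of_mem_rules (hw : ∀ r ∈ P.properRules, r.WidthLE w) (hr : r ∈ P.rules) :
    r.WidthLE w := by
  by_cases hfact : r.IsFact
  · have hbody := PRule.body_eq_nil_of_isFact hfact
    constructor <;> simp [PRule.vars, hbody, vars_head_eq_nil hr hfact]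
  · exact hw r (by simp [properRules, hr, hfact])

theorem sizeLE_of_mem_rules (har : ∀ p, arity p ≤ w) (hr : r ∈ P.rules) (hw : r.WidthLE w) :
    r.SizeLE w :=
  ⟨hw.length_body, fun A hA => (P.arity_eq r hr A hA).trans_le (har A.pred)⟩

variable [DecidableEq Const] [Inhabited Const]

theorem consts_subset_herbrand (P : PProgram Pred Const arity) : P.consts ⊆ P.herbrand := by
  unfold herbrand
  split_ifs with h <;> simp [h]

theorem card_herbrand_le (P : PProgram Pred Const arity) : P.herbrand.card ≤ P.dbSize + 1 := by
  unfold herbrand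
  split_ifs with h
  · simp
  · exact Nat.le_succ _

theorem subst_mem_base {A : Atom Pred (Term Const)} (hr : r ∈ P.rules) (hA : A ∈ r.head :: r.body)
    {θ : ℕ → Const} (hθ : ∀ i, θ i ∈ P.herbrand) : A.subst θ ∈ P.base := by
  refine ⟨by simpa [Atom.subst] using P.arity_eq r hr A hA, fun c hc => ?_⟩
  obtain ⟨t, ht, rfl⟩ := List.mem_map.1 hc
  cases t with
  | var i => exact hθ i
  | const c =>
    have hcA : c ∈ A.consts := List.mem_flatMap.2 ⟨_, ht, List.mem_singleton_self c⟩
    exact P.consts_subset_herbrand <| Finset.mem_biUnion.2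
      ⟨r, hr, List.mem_toFinset.2 <| List.mem_flatMap.2 ⟨A, hA, hcA⟩⟩

section FinitePred

variable [Finite Pred]

theorem exists_length_le_mem_iff_mem_base (P : PProgram Pred Const arity)
    (har : ∀ p, arity p ≤ w) : ∃ as : List (Atom Pred Const),
      as.length ≤ Nat.card Pred * (P.dbSize + 2) ^ w ∧ ∀ A, A ∈ as ↔ A ∈ P.base := by
  have := Fintype.ofFinite Pred
  refine ⟨Naive.groundAtoms arity Finset.univ.toList P.herbrand.toList,
    Naive.length_groundAtoms_le ?_ ?_ har, fun A => Naive.mem_groundAtoms (by simp) (by simp)⟩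
  · simp [Nat.card_eq_fintype_card]
  · simpa using P.card_herbrand_le

theorem finite_base (P : PProgram Pred Const arity) : P.base.Finite := by
  obtain ⟨k, hk⟩ := Finite.exists_le arity
  obtain ⟨as, -, has⟩ := P.exists_length_le_mem_iff_mem_base hk
  exact as.finite_toSet.subset fun A => (has A).2

theorem ncard_base_le (P : PProgram Pred Const arity) (har : ∀ p, arity p ≤ w) :
    P.base.ncard ≤ Nat.card Pred * (P.dbSize + 2) ^ w := by
  classical
  obtain ⟨as, hlen, has⟩ := P.exists_length_le_mem_iff_mem_base har
  have hbase : P.base = as.toFinset := by ext A; simp [has]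
  rw [hbase, Set.ncard_coe_finset]
  exact as.toFinset_card_le.trans hlen

theorem card_rules_le {m : ℕ} (P : PProgram Pred Const arity)
    (hm : ∀ A, (P.factsFor A).card ≤ m) :
    P.rules.card ≤ P.properRules.card + m * P.base.ncard := by
  classical
  obtain ⟨c, hc⟩ := P.herbrand_nonempty
  have hhead : ∀ r ∈ P.rules.filter PRule.IsFact,
      r.head ∈ P.finite_base.toFinset.image Atom.ofGround := fun r hr => by
    obtain ⟨hr, hfact⟩ := Finset.mem_filter.1 hr
    refine Finset.mem_image.2 ⟨r.head.subst fun _ => c, ?_,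
      Atom.ofGround_subst (vars_head_eq_nil hr hfact) _⟩
    exact P.finite_base.mem_toFinset.2 (subst_mem_base hr List.mem_cons_self fun _ => hc)
  have hfacts : (P.rules.filter PRule.IsFact).card ≤ m * P.base.ncard := calc
    _ ≤ m * (P.finite_base.toFinset.image Atom.ofGround).card :=
      Finset.card_le_mul_card_image_of_maps_to hhead m fun A _ => by
        simpa [factsFor, Finset.filter_filter] using hm A
    _ ≤ m * P.base.ncard := by
      rw [Set.ncard_eq_toFinset_card _ P.finite_base]
      exact Nat.mul_le_mul_left m Finset.card_image_le
  rw [← Finset.card_filter_add_card_filter_not PRule.IsFact, Nat.add_comm]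
  exact Nat.add_le_add_left hfacts _

end FinitePred

end PProgram

namespace Naive

/-- A bound on the cost of naive evaluation in terms of the width `w` of the p-rules and the
numbers `p` of predicates, `L` of p-rules and `n` of constants. It is defined over an arbitrary
semiring, so that it can be read as a number and as a polynomial. -/
def evaluationBound {S : Type*} [CommSemiring S] (w : ℕ) (p L n : S) : S :=
  100 * (p + L + 1) ^ 2 * (w + 1) ^ 4 * ((n + 2) ^ w) ^ 2 +
    (p * (n + 2) ^ w + 1) *
      (50 * (L * (n + 2) ^ w + 1) * (p * (n + 2) ^ w + 1) ^ 2 * (w + 1) ^ 2 + 1)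

variable [DecidableEq Pred] [DecidableEq Const] [Inhabited Const]
  {arity : Pred → ℕ} {P : PProgram Pred Const arity} {preds : List Pred}
  {rules : List (PRule Pred (Term Const))}

theorem isGrounding_setup (hpreds : ∀ p, p ∈ preds) (hrules : ∀ r, r ∈ rules ↔ r ∈ P.rules) :
    IsGrounding P (groundAtoms arity preds (herbrandList rules))
      (groundRules (herbrandList rules) rules).val :=
  ⟨fun _ => mem_groundAtoms hpreds fun _ => mem_herbrandList hrules,
    fun _ => mem_groundRules hrules fun _ => mem_herbrandList hrules, nodup_groundRules _ _⟩

theorem val_setup_eq_tableOf_falseVal (P : PProgram Pred Const arity) (preds : List Pred)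
    (rules : List (PRule Pred (Term Const))) :
    (setup arity preds rules).val.2 =
      tableOf (groundAtoms arity preds (herbrandList rules)) (P.value P.falseVal) := by
  have hfalse A : P.value P.falseVal A = Conf.falsum := by
    simp [PProgram.value, PProgram.falseVal]
  rw [val_setup]
  exact List.map_congr_left fun A _ => congrArg (Prod.mk A) (hfalse A).symm

theorem length_le_and_le_and_sum_le {s S N I : ℕ} {costs : List ℕ} (hs : s ≤ S)
    (hlen : costs.length ≤ N) (hI : ∀ c ∈ costs, c ≤ I) :
    costs.length ≤ S + N * (I + 1) ∧ (∀ c ∈ costs, c ≤ S + N * (I + 1)) ∧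
      s + costs.sum ≤ S + N * (I + 1) := by
  have hsum : costs.sum ≤ N * I :=
    (List.sum_le_card_nsmul costs I hI).trans (Nat.mul_le_mul_right I hlen)
  rw [Nat.mul_succ]
  exact ⟨by omega, fun c hc => by have := List.le_sum_of_mem hc; omega, by omega⟩

theorem exists_halts [Finite Pred] {w L : ℕ} (hrec : ∀ p, P.Recursive p → P.disj p = .pc)
    (hpnd : preds.Nodup) (hpreds : ∀ p, p ∈ preds) (hrules : ∀ r, r ∈ rules ↔ r ∈ P.rules)
    (hL : rules.length ≤ L) (har : ∀ p, arity p ≤ w) (hw : ∀ r ∈ P.rules, r.WidthLE w) :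
    ∃ (s : ℕ) (costs : List ℕ) (out : Table Pred Const),
      Halts arity P.disj preds rules s costs out ∧
      P.immCons^[costs.length] P.falseVal = P.stage P.base.ncard ∧
      (∀ A c, (A, c) ∈ out ↔ ∃ h : A ∈ P.base, P.stage P.base.ncard ⟨A, h⟩ = c) ∧
      costs.length ≤ evaluationBound w (Nat.card Pred) L P.dbSize ∧
      (∀ t ∈ costs, t ≤ evaluationBound w (Nat.card Pred) L P.dbSize) ∧
      s + costs.sum ≤ evaluationBound w (Nat.card Pred) L P.dbSize := by
  have hp : preds.length ≤ Nat.card Pred := by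
    have := Fintype.ofFinite Pred
    exact Nat.card_eq_fintype_card (α := Pred) ▸ hpnd.length_le_card
  have hu := length_herbrandList_le hrules
  have hsize r (hr : r ∈ rules) : r.SizeLE w :=
    P.sizeLE_of_mem_rules har ((hrules r).1 hr) (hw r ((hrules r).1 hr))
  have hvars r (hr : r ∈ rules) := (hw r ((hrules r).1 hr)).lt_of_mem_vars
  have hlen := length_groundAtoms_le hp hu har
  have hgrounding := isGrounding_setup hpreds hrules
  obtain ⟨costs, hloop, hfix, hcosts, htime⟩ := hgrounding.exists_loop
    (fun v => time_iteration_le P.disj (length_groundRules_le hL hu hvars)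
      (fun _ => sizeLE_of_mem_groundRules hsize) ((List.length_map _).trans_le hlen))
    (PProgram.stage_ncard_base hrec P.finite_base)
  have hsetup := time_setup_le hp hL hu hsize hvars har
  rw [← val_setup_eq_tableOf_falseVal] at hloop
  have hnumber := hcosts.trans (Nat.succ_le_succ (P.ncard_base_le har))
  refine ⟨_, costs, _, ⟨rfl, by rw [val_setup] at hloop ⊢; exact hloop⟩, hfix,
    fun A c => hgrounding.mem_tableOf _, ?_⟩
  simp only [evaluationBound, Nat.cast_id]
  exact length_le_and_le_and_sum_le hsetup hnumber htime

end Naive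

end PDatalog

open PDatalog in
theorem theorem7p2_general {Pred Const : Type} [Finite Pred] [DecidableEq Pred]
    [DecidableEq Const] [Inhabited Const] (arity : Pred → ℕ) (w ℓ m : ℕ) :
    ∃ q : Polynomial ℕ, ∀ P : PProgram Pred Const arity,
      P.properRules.card ≤ ℓ → (∀ r ∈ P.properRules, r.WidthLE w) →
      (∀ A, (P.factsFor A).card ≤ m) → (∀ p, P.Recursive p → P.disj p = Mode.pc) →
      ∃ v : P.Valuation, IsLeast {u | P.immCons u = u} v ∧
        ∀ (preds : List Pred) (rules : List (PRule Pred (Term Const))),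
          preds.Nodup → (∀ p, p ∈ preds) → rules.Nodup → (∀ r, r ∈ rules ↔ r ∈ P.rules) →
          ∃ (s : ℕ) (costs : List ℕ) (out : Naive.Table Pred Const),
            Naive.Halts arity P.disj preds rules s costs out ∧
            P.immCons^[costs.length] P.falseVal = v ∧
            (∀ A c, (A, c) ∈ out ↔ ∃ h : A ∈ P.base, v ⟨A, h⟩ = c) ∧
            costs.length ≤ q.eval P.dbSize ∧
            (∀ t ∈ costs, t ≤ q.eval P.dbSize) ∧
            s + costs.sum ≤ q.eval P.dbSize := by
  obtain ⟨k, hk⟩ := Finite.exists_le arity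
  refine ⟨Naive.evaluationBound (max w k) (.C (Nat.card Pred))
    (.C ℓ + .C m * (.C (Nat.card Pred) * (.X + 2) ^ max w k)) .X, fun P hℓ hw hm hrec => ?_⟩
  have har p : arity p ≤ max w k := (hk p).trans (le_max_right _ _)
  refine ⟨_, P.isLeast_stage P.finite_base hrec, fun preds rules hpnd hpreds hrnd hrules => ?_⟩
  have hsub : (⟨rules, Multiset.coe_nodup.2 hrnd⟩ : Finset _) ⊆ P.rules :=
    fun r hr => (hrules r).1 hr
  have hL : rules.length ≤ ℓ + m * (Nat.card Pred * (P.dbSize + 2) ^ max w k) := calc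
    rules.length ≤ P.rules.card := Finset.card_le_card hsub
    _ ≤ P.properRules.card + m * P.base.ncard := P.card_rules_le hm
    _ ≤ _ := Nat.add_le_add hℓ (Nat.mul_le_mul_left m (P.ncard_base_le har))
  simpa [Naive.evaluationBound] using Naive.exists_halts hrec hpnd hpreds hrules hL har fun r hr =>
    P.widthLE_of_mem_rules (fun r hr => (hw r hr).mono (le_max_left _ _)) hr

open PDatalog in
theorem theorem7p2 {Pred Const : Type} [Fintype Pred] [DecidableEq Pred]
    [DecidableEq Const] [Inhabited Const] (arity : Pred → ℕ)
    (R : Finset (PRule Pred (Term Const))) (modes : Pred → Mode) (m : ℕ) :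
    ∃ q : Polynomial ℕ, ∀ P : PProgram Pred Const arity,
      P.properRules = R → P.disj = modes → (∀ A, (P.factsFor A).card ≤ m) →
      (∀ p, P.Recursive p → P.disj p = Mode.pc) →
      ∃ v : P.Valuation, IsLeast {u | P.immCons u = u} v ∧
        ∀ (preds : List Pred) (rules : List (PRule Pred (Term Const))),
          preds.Nodup → (∀ p, p ∈ preds) → rules.Nodup → (∀ r, r ∈ rules ↔ r ∈ P.rules) →
          ∃ (s : ℕ) (costs : List ℕ) (out : Naive.Table Pred Const),
            Naive.Halts arity P.disj preds rules s costs out ∧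
            P.immCons^[costs.length] P.falseVal = v ∧
            (∀ A c, (A, c) ∈ out ↔ ∃ h : A ∈ P.base, v ⟨A, h⟩ = c) ∧
            costs.length ≤ q.eval P.dbSize ∧
            (∀ t ∈ costs, t ≤ q.eval P.dbSize) ∧
            s + costs.sum ≤ q.eval P.dbSize := by
  obtain ⟨w, hw⟩ := PRule.exists_widthLE R
  obtain ⟨q, hq⟩ := theorem7p2_general (Const := Const) arity w R.card m
  exact ⟨q, fun P hR _ => hq P (hR ▸ le_rfl) (hR ▸ hw)⟩
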